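/- Let $2<\alpha<4$ and $c>0$. Let $m(z)=\int_{-2}^{2}\frac{1}{z-x}\,\frac{\sqrt{4-x^2}}{2\pi}\,dx$ be the Stieltjes transform of the semicircle law on $[-2,2]$, and for $z\in\mathbb C\setminus\mathbb R$, $t>0$ put $\operatorname{sgn}_z=\operatorname{sgn}(\operatorname{Im} z)$ and $K(z,t)=\operatorname{sgn}_z\, i t\, m(z)$. For $z,w\in\mathbb C\setminus\mathbb R$ let $$C(z,w)=\iint_{t,s>0}\partial_z\partial_w\Big\{\big[(K(z,t)+K(w,s))^{\alpha/2}-(K(z,t)^{\alpha/2}+K(w,s)^{\alpha/2})\big]\,e^{\operatorname{sgn}_z itz-K(z,t)+\operatorname{sgn}_w isw-K(w,s)}\Big\}\frac{c\,dt\,ds}{ts}$$ (principal powers). Put $$k_\alpha=\frac{\Gamma(2-\frac\alpha2)}{\frac\alpha2(\frac\alpha2-1)}.$$ For $u>0$ let $\Lambda_u$ be the signed measure $$\Lambda_u=-\frac1\pi\,\frac{2u^4+2u^2-u^2x^2}{\sqrt{4-x^2}\,\big(-u^2x^2+u^4+2u^2+1\big)}\mathbf 1_{|x|\le2}\,dx+\big(\delta_{u+u^{-1}}+\delta_{-u-u^{-1}}\big)\mathbf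 1_{u\ge1},$$ and for bounded continuous $\psi,\phi:\mathbb R\to\mathbb C$ put $$\langle\mathcal K_\alpha,\phi\otimes\psi\rangle=\frac{2c}{k_\alpha}\int_0^\infty\frac{\Lambda_u(\psi)\Lambda_u(\phi)}{u^{1+\alpha}}\,du .$$ Then the integral defining $C(z,w)$ converges absolutely for all $z,w\in\mathbb C\setminus\mathbb R$, the density of the absolutely continuous part of $\Lambda_u$ is integrable for every $u>0$, and: 1. For all bounded continuous $\psi,\phi:\mathbb R\to\mathbb C$ (in particular real-valued ones), the integral defining $\langle\mathcal K_\alpha,\phi\otimes\psi\rangle$ converges absolutely; for all $\eta_1,\eta_2>0$, with $z=E+i\eta_1$ and $w=F+i\eta_2$, so does the integral $$-\frac1{4\pi^2}\iint_{\mathbb R^2}\big\{C(z,w)+C(\bar z,\bar w)-C(\bar z,w)-C(z,\bar w)\big\}\psi(E)\phi(F)\,dE\,dF ;$$ and the latter converges to $\langle\mathcal K_\alpha,\phi\otimes\psi\rangle$ as $\eta_1,\eta_2\downarrow0$ (jointly). 2. For all $z,w\in\mathbb C\setminus\mathbb R$, with $\psi(x)=(z-x)^{-1}$ and $\phi(y)=(w-y)^{-1}$,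 one has $\langle\mathcal K_\alpha,\phi\otimes\psi\rangle=C(z,w)$. -/

import Mathlib

open Real Set Filter Topology MeasureTheory
open scoped BoundedContinuousFunction ComplexConjugate

namespace HalfHeavyTail

noncomputable section

/-- Stieltjes transform `m(z) = ∫ σ(dx) / (z - x)` of the semicircle law
`σ(dx) = (2π)⁻¹ √(4 - x²) dx` on `[-2, 2]`. -/
def semicircleStieltjes (z : ℂ) : ℂ :=
  ∫ x in (-2 : ℝ)..2, ((√(4 - x ^ 2) / (2 * π) : ℝ) : ℂ) / (z - (x : ℂ))

/-- `K(z, t) = sgn(Im z) i t m(z)`. -/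
def covExponent (z : ℂ) (t : ℝ) : ℂ :=
  (Real.sign z.im : ℂ) * Complex.I * (t : ℂ) * semicircleStieltjes z

/-- The function of `(z, w)` that is differentiated in the integral defining the covariance:
`[(K(z,t) + K(w,s))^(α/2) - (K(z,t)^(α/2) + K(w,s)^(α/2))]
  * exp (sgn_z i t z - K(z,t) + sgn_w i s w - K(w,s))`, with principal powers. -/
def covBracket (α : ℝ) (z w : ℂ) (t s : ℝ) : ℂ :=
  ((covExponent z t + covExponent w s) ^ ((α / 2 : ℝ) : ℂ)
      - (covExponent z t ^ ((α / 2 : ℝ) : ℂ) + covExponent w s ^ ((α / 2 : ℝ) : ℂ)))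
    * Complex.exp ((Real.sign z.im : ℂ) * Complex.I * (t : ℂ) * z - covExponent z t
        + (Real.sign w.im : ℂ) * Complex.I * (s : ℂ) * w - covExponent w s)

/-- The integrand `∂_z ∂_w {...} c / (t s)` of the covariance, as a function of `p = (t, s)`. -/
def covIntegrand (c α : ℝ) (z w : ℂ) (p : ℝ × ℝ) : ℂ :=
  deriv (fun z' : ℂ => deriv (fun w' : ℂ => covBracket α z' w' p.1 p.2) w) z
    * ((c / (p.1 * p.2) : ℝ) : ℂ)

/-- The limiting covariance `C(z, w)` of the traces of resolvents, `z, w ∈ ℂ \ ℝ`. -/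
def resolventCov (c α : ℝ) (z w : ℂ) : ℂ :=
  ∫ p in Ioi (0 : ℝ) ×ˢ Ioi (0 : ℝ), covIntegrand c α z w p

/-- `C(z, w) + C(z̄, w̄) - C(z̄, w) - C(z, w̄)`. -/
def covJump (c α : ℝ) (z w : ℂ) : ℂ :=
  resolventCov c α z w + resolventCov c α (conj z) (conj w)
    - resolventCov c α (conj z) w - resolventCov c α z (conj w)

/-- The function of `p = (E, F)` integrated in the regularized pairing:
the jump at `z = E + i η₁`, `w = F + i η₂` times `ψ(E) φ(F)`. -/
def pairingIntegrand (c α : ℝ) (ψ φ : ℝ → ℂ) (η₁ η₂ : ℝ) (p : ℝ × ℝ) : ℂ :=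
  covJump c α ((p.1 : ℂ) + (η₁ : ℂ) * Complex.I) ((p.2 : ℂ) + (η₂ : ℂ) * Complex.I)
    * (ψ p.1 * φ p.2)

/-- The regularized pairing
`-(4π²)⁻¹ ∬ {C(z,w) + C(z̄,w̄) - C(z̄,w) - C(z,w̄)} ψ(E) φ(F) dE dF`. -/
def regularizedPairing (c α : ℝ) (ψ φ : ℝ → ℂ) (η₁ η₂ : ℝ) : ℂ :=
  -(1 / (4 * (π : ℂ) ^ 2)) * ∫ p : ℝ × ℝ, pairingIntegrand c α ψ φ η₁ η₂ p

/-- The constant `k_α`, normalized by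
`∫₀^∞ (exp (r σ) - r σ - 1) r^(-α/2 - 1) dr = k_α (-σ)^(α/2)` for `Re σ < 0`. -/
def kConst (α : ℝ) : ℝ := Real.Gamma (2 - α / 2) / (α / 2 * (α / 2 - 1))

/-- Density of the absolutely continuous part of `Λ_u` (on `[-2, 2]`). -/
def lambdaDensity (u x : ℝ) : ℝ :=
  -(1 / π * ((2 * u ^ 4 + 2 * u ^ 2 - u ^ 2 * x ^ 2)
    / (√(4 - x ^ 2) * (-u ^ 2 * x ^ 2 + u ^ 4 + 2 * u ^ 2 + 1))))

/-- `Λ_u(ψ)`: the signed measure `Λ_u` consists of the density `lambdaDensity u` on `[-2, 2]`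
and, if `u ≥ 1`, of unit point masses at `u + u⁻¹` and `-u - u⁻¹`. -/
def lambdaApply (u : ℝ) (ψ : ℝ → ℂ) : ℂ :=
  (∫ x in Icc (-2 : ℝ) 2, (lambdaDensity u x : ℂ) * ψ x)
    + if 1 ≤ u then ψ (u + u⁻¹) + ψ (-u - u⁻¹) else 0

/-- The function of `u` integrated in the limiting pairing. -/
def kernelIntegrand (α : ℝ) (ψ φ : ℝ → ℂ) (u : ℝ) : ℂ :=
  lambdaApply u ψ * lambdaApply u φ / ((u ^ (1 + α) : ℝ) : ℂ)

/-- The limiting pairing `(2 c / k_α) ∫₀^∞ Λ_u(ψ) Λ_u(φ) u^(-1-α) du`. -/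
def kernelPairing (c α : ℝ) (ψ φ : ℝ → ℂ) : ℂ :=
  ((2 * c / kConst α : ℝ) : ℂ) * ∫ u in Ioi (0 : ℝ), kernelIntegrand α ψ φ u

end

end HalfHeavyTail

namespace HalfHeavyTail

noncomputable section

/-! ### The arcsine integral -/

/-! Everything reduces to one formula: `C(z, w)` is the `u`-integral of `Λ_u((z - ·)⁻¹) Λ_u((w -
·)⁻¹)` against `(2c / k_α) u^(-1-α) du`.

Put `κ = sgn_z i m(z)`, so that `Re κ > 0` and `K(z, t) = tκ`. The equation `m + m⁻¹ = z` turns the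
exponential in the bracket into `e^(-t/κ(z)) e^(-s/κ(w))`. The bracket of powers is a mixture of
products: `k_α [(x+y)^(α/2) - x^(α/2) - y^(α/2)]` equals `∫ r^(-α/2-1) (1 - e^(-rx)) (1 - e^(-ry))
dr` (`integral_one_sub_exp_mul_one_sub_exp`). For fixed `r` the variables `(z, t)` and `(w, s)`
therefore separate. Differentiating under the integral produces a factor `ts`, which cancels the
weight `1/(ts)`. The `t`-integral is elementary, with value `2r / (rκ + κ⁻¹)`, and after `r = u²`
each factor becomes `2u²m³ / ((1 - m²)(1 - u²m²))`, called `lambdaResolvent u z`. This gives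
`covIntegrand_integrableOn_and_integral`.

On the other side, partial fractions and the Stieltjes transform of the arcsine law show that `Λ_u`
applied to `(z - ·)⁻¹` is the same rational function of `m` (`lambdaApply_resolvent`). The claim
about resolvents follows.

For general test functions, the four-term jump of `C` is the product `(R(z) - R(z̄))(R(w) - R(w̄))`
under the `u`-integral, with `R = lambdaResolvent u`. Each difference is `-2i` times the Poisson
integral of `Λ_u`, so the regularized pairing is exactly the limiting pairing evaluated at Cauchy
averages of `ψ` and `φ` (`regularizedPairing_spec`). The limit is then dominated convergence: the
total variation of `Λ_u` is at most `12 min(1, u²)` for `u ≠ 1`, and `min(1, u²)² u^(-1-α)` is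
integrable because `0 < α < 4`. -/

lemma one_sub_mul_exp_ne_zero {m : ℂ} (hm : ‖m‖ < 1) (θ : ℝ) :
    1 - m * Complex.exp (θ * Complex.I) ≠ 0 := by
  intro h
  have h1 : m * Complex.exp (θ * Complex.I) = 1 := (sub_eq_zero.1 h).symm
  have h2 := congrArg norm h1
  rw [norm_mul, Complex.norm_exp_ofReal_mul_I, mul_one, norm_one] at h2
  linarith

/-- Mean value property: `ζ ↦ (1 - mζ)⁻¹` is holomorphic on the disc, so its average over the unit
circle is its value `1` at the centre. -/
lemma integral_inv_one_sub_mul_exp {m : ℂ} (hm : ‖m‖ < 1) :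
    ∫ θ in (-π)..π, (1 - m * Complex.exp (θ * Complex.I))⁻¹ = 2 * π := by
  have hne : ∀ ζ ∈ Metric.closedBall (0 : ℂ) 1, 1 - m * ζ ≠ 0 := by
    intro ζ hζ h
    have h2 := congrArg norm (sub_eq_zero.1 h).symm
    rw [norm_mul, norm_one] at h2
    have : ‖ζ‖ ≤ 1 := by simpa using hζ
    nlinarith [norm_nonneg m, norm_nonneg ζ]
  have h1 : Real.circleAverage (fun ζ : ℂ => (1 - m * ζ)⁻¹) 0 1 = 1 := by
    have hd : DiffContOnCl ℂ (fun ζ : ℂ => (1 - m * ζ)⁻¹) (Metric.ball 0 |(1 : ℝ)|) := by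
      rw [abs_one]
      apply DifferentiableOn.diffContOnCl
      rw [closure_ball _ one_ne_zero]
      intro ζ hζ
      exact ((by fun_prop : DifferentiableAt ℂ (fun ζ : ℂ => 1 - m * ζ) ζ).inv
        (hne ζ hζ)).differentiableWithinAt
    simpa using hd.circleAverage
  rw [Real.circleAverage_def] at h1
  have hper : Function.Periodic
      (fun θ : ℝ => (1 - m * Complex.exp (θ * Complex.I))⁻¹) (2 * π) := by
    intro θ
    simp only
    push_cast
    rw [add_mul, Complex.exp_periodic]
  have h2 := hper.intervalIntegral_add_eq 0 (-π)
  rw [zero_add, show -π + 2 * π = π by ring] at h2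
  rw [← h2]
  simp only [circleMap, zero_add, Complex.ofReal_one, one_mul] at h1
  have hpi : ((2 * π : ℝ) : ℂ) ≠ 0 := by exact_mod_cast Real.two_pi_pos.ne'
  rw [Complex.real_smul, Complex.ofReal_inv, inv_mul_eq_iff_eq_mul₀ hpi] at h1
  rw [h1]; push_cast; ring

lemma one_add_sq_sub_eq (m : ℂ) (θ : ℝ) : 1 + m ^ 2 - 2 * m * (Real.cos θ : ℂ) =
    (1 - m * Complex.exp (θ * Complex.I)) * (1 - m * Complex.exp ((-θ : ℝ) * Complex.I)) := by
  have h1 : Complex.exp (θ * Complex.I) * Complex.exp ((-θ : ℝ) * Complex.I) = 1 := by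
    rw [← Complex.exp_add]; simp
  have h2 : 2 * (Real.cos θ : ℂ) =
      Complex.exp (θ * Complex.I) + Complex.exp ((-θ : ℝ) * Complex.I) := by
    rw [Complex.ofReal_cos, Complex.cos]; push_cast; ring_nf
  linear_combination (-m) * h2 - m ^ 2 * h1

lemma one_add_sq_sub_ne_zero {m : ℂ} (hm : ‖m‖ < 1) (θ : ℝ) :
    1 + m ^ 2 - 2 * m * (Real.cos θ : ℂ) ≠ 0 := by
  rw [one_add_sq_sub_eq]
  exact mul_ne_zero (one_sub_mul_exp_ne_zero hm _) (one_sub_mul_exp_ne_zero hm _)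

lemma one_sub_sq_ne_zero {m : ℂ} (hm : ‖m‖ < 1) : 1 - m ^ 2 ≠ 0 := by
  intro h
  have h2 := congrArg norm (sub_eq_zero.1 h).symm
  rw [norm_pow, norm_one] at h2
  nlinarith [norm_nonneg m]

/-- Partial fractions in `e^(iθ)` give `(1 - m²)⁻¹ (g(θ) + g(-θ) - 1)`; the reflected term completes
the half period to a full one, leaving `2π - π`. -/
lemma integral_inv_one_add_sq_sub {m : ℂ} (hm : ‖m‖ < 1) :
    ∫ θ in (0 : ℝ)..π, (1 + m ^ 2 - 2 * m * (Real.cos θ : ℂ))⁻¹ = π / (1 - m ^ 2) := by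
  set g : ℝ → ℂ := fun θ => (1 - m * Complex.exp (θ * Complex.I))⁻¹ with hg
  have hcont : Continuous g := by
    rw [hg]
    exact Continuous.inv₀ (by fun_prop) (fun θ => one_sub_mul_exp_ne_zero hm θ)
  have hcont' : Continuous fun θ => g (-θ) := hcont.comp continuous_neg
  have key : ∀ θ : ℝ, (1 + m ^ 2 - 2 * m * (Real.cos θ : ℂ))⁻¹
      = (1 - m ^ 2)⁻¹ * (g θ + g (-θ) - 1) := by
    intro θ
    have h0 := one_sub_mul_exp_ne_zero hm θ
    have h0' := one_sub_mul_exp_ne_zero hm (-θ)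
    have h1 : Complex.exp (θ * Complex.I) * Complex.exp ((-θ : ℝ) * Complex.I) = 1 := by
      rw [← Complex.exp_add]; simp
    have hm2 := one_sub_sq_ne_zero hm
    rw [one_add_sq_sub_eq]
    simp only [hg]
    generalize Complex.exp (θ * Complex.I) = p at *
    generalize Complex.exp ((-θ : ℝ) * Complex.I) = q at *
    field_simp
    linear_combination (m ^ 2) * h1
  simp_rw [key]
  rw [intervalIntegral.integral_const_mul, intervalIntegral.integral_sub
    (show IntervalIntegrable (fun θ => g θ + g (-θ)) volume 0 π from
      (hcont.add hcont').intervalIntegrable _ _) intervalIntegrable_const,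
    intervalIntegral.integral_add (hcont.intervalIntegrable _ _) (hcont'.intervalIntegrable _ _),
    intervalIntegral.integral_comp_neg, neg_zero, add_comm (∫ x in (0 : ℝ)..π, g x),
    intervalIntegral.integral_add_adjacent_intervals (hcont.intervalIntegrable _ _)
      (hcont.intervalIntegrable _ _), integral_inv_one_sub_mul_exp hm]
  simp
  ring

/-- Substitution `x = 2 cos θ`. -/
lemma image_two_mul_cos : (fun θ : ℝ => 2 * Real.cos θ) '' Ioo 0 π = Ioo (-2 : ℝ) 2 := by
  ext x
  constructor
  · rintro ⟨θ, hθ, rfl⟩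
    have h1 := Real.cos_lt_cos_of_nonneg_of_le_pi le_rfl hθ.2.le hθ.1
    have h2 := Real.cos_lt_cos_of_nonneg_of_le_pi hθ.1.le le_rfl hθ.2
    simp at h1 h2
    constructor <;> simp only <;> linarith
  · intro hx
    refine ⟨Real.arccos (x / 2), ⟨Real.arccos_pos.2 (by linarith [hx.2]), ?_⟩, ?_⟩
    · rw [Real.arccos_lt_pi]; linarith [hx.1]
    · simp only
      rw [Real.cos_arccos (by linarith [hx.1]) (by linarith [hx.2])]; ring

lemma sqrt_four_sub_two_mul_cos_sq {θ : ℝ} (hθ : θ ∈ Ioo 0 π) :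
    √(4 - (2 * Real.cos θ) ^ 2) = 2 * Real.sin θ := by
  rw [show 4 - (2 * Real.cos θ) ^ 2 = (2 * Real.sin θ) ^ 2 by
    nlinarith [Real.sin_sq_add_cos_sq θ]]
  exact Real.sqrt_sq (by linarith [Real.sin_pos_of_mem_Ioo hθ])

section
variable {E : Type*} [NormedAddCommGroup E] [NormedSpace ℝ E]

lemma hasDerivWithinAt_two_mul_cos (θ : ℝ) (s : Set ℝ) :
    HasDerivWithinAt (fun θ : ℝ => 2 * Real.cos θ) (2 * -Real.sin θ) s θ :=
  ((Real.hasDerivAt_cos θ).const_mul 2).hasDerivWithinAt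

lemma injOn_two_mul_cos : InjOn (fun θ : ℝ => 2 * Real.cos θ) (Ioo 0 π) := by
  intro a ha b hb hab
  exact Real.injOn_cos (Ioo_subset_Icc_self ha) (Ioo_subset_Icc_self hb) (by simpa using hab)

/-- On `(0, π)` the Jacobian `2 sin θ` of `x = 2 cos θ` cancels the arcsine weight exactly, so the
singularities at `±2` disappear. -/
lemma arcsine_congr (f : ℝ → E) : EqOn
    (fun θ => |2 * -Real.sin θ| • (√(4 - (2 * Real.cos θ) ^ 2))⁻¹ • f (2 * Real.cos θ))
    (fun θ => f (2 * Real.cos θ)) (Ioo 0 π) := by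
  intro θ hθ
  have hs := Real.sin_pos_of_mem_Ioo hθ
  simp only
  rw [sqrt_four_sub_two_mul_cos_sq hθ, smul_smul, mul_neg, abs_neg, abs_of_pos (by positivity),
    mul_inv_cancel₀ (by positivity), one_smul]

lemma integrableOn_arcsine_iff (f : ℝ → E) :
    IntegrableOn (fun x : ℝ => (√(4 - x ^ 2))⁻¹ • f x) (Icc (-2) 2) ↔
      IntegrableOn (fun θ => f (2 * Real.cos θ)) (Ioo 0 π) := by
  rw [integrableOn_Icc_iff_integrableOn_Ioo, ← image_two_mul_cos,
    integrableOn_image_iff_integrableOn_abs_deriv_smul measurableSet_Ioo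
      (fun θ _ => hasDerivWithinAt_two_mul_cos θ _) injOn_two_mul_cos]
  exact integrableOn_congr_fun (arcsine_congr f) measurableSet_Ioo

lemma integral_arcsine (f : ℝ → E) :
    ∫ x in Icc (-2 : ℝ) 2, (√(4 - x ^ 2))⁻¹ • f x = ∫ θ in (0 : ℝ)..π, f (2 * Real.cos θ) := by
  rw [integral_Icc_eq_integral_Ioo, ← image_two_mul_cos,
    integral_image_eq_integral_abs_deriv_smul measurableSet_Ioo
      (fun θ _ => hasDerivWithinAt_two_mul_cos θ _) injOn_two_mul_cos,
    setIntegral_congr_fun measurableSet_Ioo (arcsine_congr f),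
    intervalIntegral.integral_of_le Real.pi_pos.le, integral_Ioc_eq_integral_Ioo]

lemma integrableOn_arcsine_of_continuousOn {f : ℝ → E} (hf : ContinuousOn f (Icc (-2) 2)) :
    IntegrableOn (fun x : ℝ => (√(4 - x ^ 2))⁻¹ • f x) (Icc (-2) 2) := by
  rw [integrableOn_arcsine_iff]
  have hc : ContinuousOn (fun θ => f (2 * Real.cos θ)) (Icc 0 π) :=
    hf.comp (by fun_prop) (fun θ _ => ⟨by linarith [Real.neg_one_le_cos θ],
      by linarith [Real.cos_le_one θ]⟩)
  exact hc.integrableOn_Icc.mono_set Ioo_subset_Icc_self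

end

/-- The Stieltjes transform of the arcsine law at `m + m⁻¹`. -/
lemma integral_arcsine_inv_sub {m : ℂ} (hm : ‖m‖ < 1) (h0 : m ≠ 0) :
    ∫ x in Icc (-2 : ℝ) 2, (√(4 - x ^ 2))⁻¹ • (m + m⁻¹ - (x : ℂ))⁻¹ = π * (m / (1 - m ^ 2)) := by
  rw [integral_arcsine]
  have : ∀ θ : ℝ, (m + m⁻¹ - ((2 * Real.cos θ : ℝ) : ℂ))⁻¹
      = m * (1 + m ^ 2 - 2 * m * (Real.cos θ : ℂ))⁻¹ := by
    intro θ
    rw [← inv_inv m, ← mul_inv, inv_inv]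
    congr 1
    push_cast
    field_simp
    ring
  simp_rw [this]
  rw [intervalIntegral.integral_const_mul, integral_inv_one_add_sq_sub hm]
  ring

/-- The Joukowski map sends the punctured open unit disc off the cut: with `x = 2 cos θ`, the
difference times `m` is `(1 - m e^(iθ))(1 - m e^(-iθ))`. -/
lemma add_inv_sub_ofReal_ne_zero {m : ℂ} (hm : ‖m‖ < 1) (h0 : m ≠ 0) {x : ℝ}
    (hx : x ∈ Icc (-2 : ℝ) 2) : m + m⁻¹ - (x : ℂ) ≠ 0 := by
  have hc : Real.cos (Real.arccos (x / 2)) = x / 2 :=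
    Real.cos_arccos (by linarith [hx.1]) (by linarith [hx.2])
  have h := one_add_sq_sub_ne_zero hm (Real.arccos (x / 2))
  rw [hc] at h
  intro h1
  apply h
  push_cast
  field_simp at h1
  linear_combination h1

lemma integrableOn_arcsine_inv_sub {m : ℂ} (hm : ‖m‖ < 1) (h0 : m ≠ 0) :
    IntegrableOn (fun x : ℝ => (√(4 - x ^ 2))⁻¹ • (m + m⁻¹ - (x : ℂ))⁻¹) (Icc (-2) 2) := by
  apply integrableOn_arcsine_of_continuousOn
  exact ContinuousOn.inv₀ (by fun_prop) (fun x hx => add_inv_sub_ofReal_ne_zero hm h0 hx)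

lemma integral_arcsine_one : ∫ x in Icc (-2 : ℝ) 2, (√(4 - x ^ 2))⁻¹ • (1 : ℂ) = π := by
  rw [integral_arcsine]; simp

lemma integral_arcsine_id : ∫ x in Icc (-2 : ℝ) 2, (√(4 - x ^ 2))⁻¹ • (x : ℂ) = 0 := by
  rw [integral_arcsine]
  rw [intervalIntegral.integral_ofReal, intervalIntegral.integral_const_mul, integral_cos]
  simp

/-! ### The Stieltjes transform of the semicircle law -/

/-- Write `√(4 - x²)` as `(4 - x²) / √(4 - x²)` and divide by `z - x`: the quotient is `(4 - z²)/(z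
- x) + z + x`, which leaves only arcsine integrals. -/
lemma semicircleStieltjes_add_inv {m : ℂ} (hm : ‖m‖ < 1) (h0 : m ≠ 0) :
    semicircleStieltjes (m + m⁻¹) = m := by
  have h2 : 1 - m ^ 2 ≠ 0 := one_sub_sq_ne_zero hm
  have hpi : (π : ℂ) ≠ 0 := by exact_mod_cast Real.pi_ne_zero
  have hpt : ∀ x ∈ Ioo (-2 : ℝ) 2,
      ((√(4 - x ^ 2) / (2 * π) : ℝ) : ℂ) / (m + m⁻¹ - (x : ℂ)) =
      (2 * π : ℂ)⁻¹ * ((4 - (m + m⁻¹) ^ 2) * ((√(4 - x ^ 2))⁻¹ • (m + m⁻¹ - (x : ℂ))⁻¹)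
        + ((m + m⁻¹) * ((√(4 - x ^ 2))⁻¹ • (1 : ℂ)) + (√(4 - x ^ 2))⁻¹ • (x : ℂ))) := by
    intro x hx
    have hD := add_inv_sub_ofReal_ne_zero hm h0 (Ioo_subset_Icc_self hx)
    have hs : 0 < 4 - x ^ 2 := by nlinarith [hx.1, hx.2]
    have hs0 : ((√(4 - x ^ 2) : ℝ) : ℂ) ≠ 0 := by exact_mod_cast (Real.sqrt_pos.2 hs).ne'
    have hsq : ((√(4 - x ^ 2) : ℝ) : ℂ) ^ 2 = 4 - (x : ℂ) ^ 2 := by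
      rw [← Complex.ofReal_pow, Real.sq_sqrt hs.le]; push_cast; ring
    simp only [Complex.real_smul]
    push_cast
    generalize m + m⁻¹ = z at *
    field_simp
    linear_combination hsq
  have hi1 := integrableOn_arcsine_inv_sub hm h0
  have hi2 : IntegrableOn (fun x : ℝ => (√(4 - x ^ 2))⁻¹ • (1 : ℂ)) (Icc (-2) 2) :=
    integrableOn_arcsine_of_continuousOn continuousOn_const
  have hi3 : IntegrableOn (fun x : ℝ => (√(4 - x ^ 2))⁻¹ • (x : ℂ)) (Icc (-2) 2) :=
    integrableOn_arcsine_of_continuousOn (by fun_prop)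
  rw [semicircleStieltjes, intervalIntegral.integral_of_le (by norm_num),
    integral_Ioc_eq_integral_Ioo, setIntegral_congr_fun measurableSet_Ioo hpt,
    ← integral_Icc_eq_integral_Ioo, integral_const_mul, integral_add (hi1.const_mul _)
      (show Integrable (fun x : ℝ => (m + m⁻¹) * ((√(4 - x ^ 2))⁻¹ • (1 : ℂ))
        + (√(4 - x ^ 2))⁻¹ • (x : ℂ)) (volume.restrict (Icc (-2) 2)) from
        (hi2.const_mul _).add hi3), integral_add (hi2.const_mul _) hi3, integral_const_mul,
      integral_const_mul, integral_arcsine_inv_sub hm h0, integral_arcsine_one,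
      integral_arcsine_id]
  field_simp
  ring

/-- The two roots of `a + a⁻¹ = z` are mutually inverse, so one has modulus below `1` unless both
are unimodular, in which case `z = 2 Re a` would be real. -/
lemma exists_add_inv_eq {z : ℂ} (hz : z.im ≠ 0) : ∃ m : ℂ, ‖m‖ < 1 ∧ m ≠ 0 ∧ m + m⁻¹ = z := by
  obtain ⟨s, hs⟩ := IsAlgClosed.exists_pow_nat_eq (z ^ 2 - 4) (n := 2) (by norm_num)
  set a := (z + s) / 2 with ha
  have hab : a * ((z - s) / 2) = 1 := by rw [ha]; linear_combination -hs / 4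
  have ha0 : a ≠ 0 := left_ne_zero_of_mul_eq_one hab
  have hai : a⁻¹ = (z - s) / 2 := inv_eq_of_mul_eq_one_right hab
  have hsum : a + a⁻¹ = z := by rw [hai, ha]; ring
  rcases lt_trichotomy ‖a‖ 1 with h | h | h
  · exact ⟨a, h, ha0, hsum⟩
  · exfalso
    apply hz
    rw [← hsum, Complex.inv_eq_conj h]
    simp
  · refine ⟨a⁻¹, ?_, inv_ne_zero ha0, by rw [inv_inv, add_comm]; exact hsum⟩
    rw [norm_inv]; exact inv_lt_one_of_one_lt₀ h

/-- This algebraic characterization replaces the defining integral in all that follows. -/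
lemma semicircleStieltjes_spec {z : ℂ} (hz : z.im ≠ 0) :
    ‖semicircleStieltjes z‖ < 1 ∧ semicircleStieltjes z ≠ 0 ∧
      semicircleStieltjes z + (semicircleStieltjes z)⁻¹ = z := by
  obtain ⟨m, h1, h2, rfl⟩ := exists_add_inv_eq hz
  rw [semicircleStieltjes_add_inv h1 h2]
  exact ⟨h1, h2, rfl⟩

/-- From `(w - z)ab = (b - a)(ab - 1)` with `|a|, |b| < 1`. It supplies the continuity required to
differentiate the local inverse of `m ↦ m + m⁻¹`. -/
lemma norm_semicircleStieltjes_sub_le {z w : ℂ} (hz : z.im ≠ 0) (hw : w.im ≠ 0) :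
    ‖semicircleStieltjes w - semicircleStieltjes z‖ ≤
      ‖w - z‖ / (1 - ‖semicircleStieltjes z‖) := by
  obtain ⟨h1, h2, h3⟩ := semicircleStieltjes_spec hz
  obtain ⟨k1, k2, k3⟩ := semicircleStieltjes_spec hw
  set a := semicircleStieltjes z
  set b := semicircleStieltjes w
  have h : (w - z) * (a * b) = (b - a) * (a * b - 1) := by
    rw [← h3, ← k3]; field_simp; ring
  have h' := congrArg norm h
  rw [norm_mul, norm_mul, norm_mul] at h'
  have h4 : 1 - ‖a‖ ≤ ‖a * b - 1‖ := by
    have := norm_sub_norm_le (1 : ℂ) (a * b)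
    rw [norm_one, norm_mul, norm_sub_rev] at this
    nlinarith [norm_nonneg a, norm_nonneg b]
  rw [le_div_iff₀ (by linarith)]
  calc ‖b - a‖ * (1 - ‖a‖) ≤ ‖b - a‖ * ‖a * b - 1‖ := by gcongr
    _ = ‖w - z‖ * (‖a‖ * ‖b‖) := h'.symm
    _ ≤ ‖w - z‖ * 1 := by
        gcongr
        nlinarith [norm_nonneg a, norm_nonneg b]
    _ = _ := mul_one _

lemma eventually_im_ne_zero {z : ℂ} (hz : z.im ≠ 0) : ∀ᶠ w in 𝓝 z, w.im ≠ 0 :=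
  (Complex.continuous_im.continuousAt).eventually_ne hz

lemma hasDerivAt_semicircleStieltjes {z : ℂ} (hz : z.im ≠ 0) :
    HasDerivAt semicircleStieltjes
      (-(semicircleStieltjes z) ^ 2 / (1 - semicircleStieltjes z ^ 2)) z := by
  obtain ⟨h1, h2, h3⟩ := semicircleStieltjes_spec hz
  have hcont : ContinuousAt semicircleStieltjes z := by
    rw [ContinuousAt, tendsto_iff_norm_sub_tendsto_zero]
    have hlim : Tendsto (fun w : ℂ => ‖w - z‖ / (1 - ‖semicircleStieltjes z‖)) (𝓝 z) (𝓝 0) := by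
      have : Continuous fun w : ℂ => ‖w - z‖ / (1 - ‖semicircleStieltjes z‖) := by fun_prop
      simpa using this.tendsto z
    refine squeeze_zero' (Eventually.of_forall fun w => norm_nonneg _) ?_ hlim
    filter_upwards [eventually_im_ne_zero hz] with w hw
    exact norm_semicircleStieltjes_sub_le hz hw
  have hm2 := one_sub_sq_ne_zero h1
  have hf : HasDerivAt (fun m : ℂ => m + m⁻¹) (1 + -(semicircleStieltjes z ^ 2)⁻¹)
      (semicircleStieltjes z) := (hasDerivAt_id _).add (hasDerivAt_inv h2)
  have hne : 1 + -(semicircleStieltjes z ^ 2)⁻¹ ≠ 0 := by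
    intro h
    apply hm2
    field_simp at h
    linear_combination -h
  have := HasDerivAt.of_local_left_inverse hcont hf hne
    (by filter_upwards [eventually_im_ne_zero hz] with w hw using (semicircleStieltjes_spec hw).2.2)
  refine this.congr_deriv ?_
  rw [inv_eq_iff_eq_inv, inv_div]
  field_simp
  ring

lemma continuousAt_semicircleStieltjes {z : ℂ} (hz : z.im ≠ 0) :
    ContinuousAt semicircleStieltjes z := (hasDerivAt_semicircleStieltjes hz).continuousAt

/-- `Im z = Im m (1 - |m|⁻²)` and `|m| < 1`, so `z` and `m` lie in opposite half planes. This is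
what makes `Re κ` positive. -/
lemma sign_mul_im_semicircleStieltjes_neg {z : ℂ} (hz : z.im ≠ 0) :
    Real.sign z.im * (semicircleStieltjes z).im < 0 := by
  obtain ⟨h1, h2, h3⟩ := semicircleStieltjes_spec hz
  set m := semicircleStieltjes z
  have him : z.im = m.im * (1 - (Complex.normSq m)⁻¹) := by
    rw [← h3, Complex.add_im, Complex.inv_im]; ring
  have hn : 0 < Complex.normSq m := Complex.normSq_pos.2 h2
  have hn1 : Complex.normSq m < 1 := by
    rw [Complex.normSq_eq_norm_sq]; nlinarith [norm_nonneg m]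
  have h4 : 1 - (Complex.normSq m)⁻¹ < 0 := by
    have := (one_lt_inv₀ hn).2 hn1; linarith
  rcases lt_or_gt_of_ne hz with h | h
  · rw [Real.sign_of_neg h]; nlinarith
  · rw [Real.sign_of_pos h]; nlinarith

/-- `κ(z) = sgn(Im z) i m(z)`, so that `covExponent z t = t * rotatedStieltjes z`. -/
def rotatedStieltjes (z : ℂ) : ℂ := (Real.sign z.im : ℂ) * Complex.I * semicircleStieltjes z

lemma covExponent_eq (z : ℂ) (t : ℝ) : covExponent z t = t * rotatedStieltjes z := by
  rw [covExponent, rotatedStieltjes]; ring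

lemma rotatedStieltjes_re_pos {z : ℂ} (hz : z.im ≠ 0) : 0 < (rotatedStieltjes z).re := by
  have := sign_mul_im_semicircleStieltjes_neg hz
  simp [rotatedStieltjes]
  linarith

lemma sign_sq {z : ℂ} (hz : z.im ≠ 0) : (Real.sign z.im : ℂ) ^ 2 = 1 := by
  rcases Real.sign_apply_eq_of_ne_zero _ hz with h | h <;> simp [h]

lemma rotatedStieltjes_ne_zero {z : ℂ} (hz : z.im ≠ 0) : rotatedStieltjes z ≠ 0 := by
  intro h
  have := rotatedStieltjes_re_pos hz
  simp [h] at this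

/-- As `(sgn_z i)² = -1`, the equation `z = m + m⁻¹` leaves only the term `sgn_z i m⁻¹ = -κ⁻¹`; the
exponential in the bracket is thus `e^(-t/κ)`, which decays in `t`. -/
lemma sign_mul_I_mul_sub {z : ℂ} (hz : z.im ≠ 0) :
    (Real.sign z.im : ℂ) * Complex.I * z - rotatedStieltjes z = -(rotatedStieltjes z)⁻¹ := by
  obtain ⟨h1, h2, h3⟩ := semicircleStieltjes_spec hz
  have hs := sign_sq hz
  have hne := rotatedStieltjes_ne_zero hz
  have : ((Real.sign z.im : ℂ) * Complex.I * z - rotatedStieltjes z) * rotatedStieltjes z = -1 := by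
    have h4 : semicircleStieltjes z * z = semicircleStieltjes z ^ 2 + 1 := by
      nth_rw 2 [← h3]
      field_simp
    rw [rotatedStieltjes]
    linear_combination Complex.I ^ 2 * hs + Complex.I_sq +
      (Real.sign z.im : ℂ) ^ 2 * Complex.I ^ 2 * h4
  field_simp
  linear_combination this

lemma hasDerivAt_rotatedStieltjes {z : ℂ} (hz : z.im ≠ 0) :
    HasDerivAt rotatedStieltjes ((Real.sign z.im : ℂ) * Complex.I *
      (-(semicircleStieltjes z) ^ 2 / (1 - semicircleStieltjes z ^ 2))) z := by
  refine ((hasDerivAt_semicircleStieltjes hz).const_mul _).congr_of_eventuallyEq ?_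
  -- The sign of the imaginary part is locally constant off the real axis, so it behaves as a
  -- constant factor.
  rcases lt_or_gt_of_ne hz with h | h
  · filter_upwards [Complex.continuous_im.continuousAt.eventually_lt_const h] with w hw
    rw [rotatedStieltjes, Real.sign_of_neg hw, Real.sign_of_neg h]
  · filter_upwards [Complex.continuous_im.continuousAt.eventually_const_lt h] with w hw
    rw [rotatedStieltjes, Real.sign_of_pos hw, Real.sign_of_pos h]

/-! ### The signed measure `Λ_u` -/

/-- The denominator of the density of `Λ_u`. -/
def lambdaDenom (u x : ℝ) : ℝ := -u ^ 2 * x ^ 2 + u ^ 4 + 2 * u ^ 2 + 1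

lemma continuous_lambdaDenom (u : ℝ) : Continuous (lambdaDenom u) := by
  unfold lambdaDenom; fun_prop

lemma sq_one_sub_sq_le_lambdaDenom {x : ℝ} (u : ℝ) (hx : x ∈ Icc (-2 : ℝ) 2) :
    (1 - u ^ 2) ^ 2 ≤ lambdaDenom u x := by
  rw [lambdaDenom]
  have : x ^ 2 ≤ 4 := by nlinarith [hx.1, hx.2]
  nlinarith [sq_nonneg u]

lemma lambdaDenom_pos {u x : ℝ} (hu : 0 < u) (hu1 : u ≠ 1) (hx : x ∈ Icc (-2 : ℝ) 2) :
    0 < lambdaDenom u x := by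
  refine lt_of_lt_of_le ?_ (sq_one_sub_sq_le_lambdaDenom u hx)
  have : 1 - u ^ 2 ≠ 0 := by
    intro h
    apply hu1
    nlinarith
  positivity

lemma lambdaDenom_eq {u : ℝ} (hu : 0 < u) (x : ℝ) :
    lambdaDenom u x = u ^ 2 * ((u + u⁻¹) - x) * ((u + u⁻¹) + x) := by
  rw [lambdaDenom]; field_simp; ring

lemma lambdaDensity_eq (u x : ℝ) : lambdaDensity u x = (√(4 - x ^ 2))⁻¹ •
    (-(1 / π) * ((2 * u ^ 4 + 2 * u ^ 2 - u ^ 2 * x ^ 2) / lambdaDenom u x)) := by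
  rw [lambdaDensity, lambdaDenom, smul_eq_mul, div_mul_eq_div_div, div_eq_mul_inv _ (√(4 - x ^ 2))]
  ring

/-- Separates the arcsine law itself from a term whose only poles are the simple ones at `±(u +
u⁻¹)`. -/
lemma lambdaDensity_eq' {u x : ℝ} (h : lambdaDenom u x ≠ 0) :
    lambdaDensity u x = (√(4 - x ^ 2))⁻¹ • (-(1 / π) * (1 - (1 - u ^ 4) / lambdaDenom u x)) := by
  rw [lambdaDensity_eq, one_sub_div h, show 2 * u ^ 4 + 2 * u ^ 2 - u ^ 2 * x ^ 2 =
    lambdaDenom u x - (1 - u ^ 4) by rw [lambdaDenom]; ring]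

lemma integrableOn_lambdaDensity {u : ℝ} (hu : 0 < u) :
    IntegrableOn (lambdaDensity u) (Icc (-2 : ℝ) 2) := by
  rw [funext (lambdaDensity_eq u)]
  rcases eq_or_ne u 1 with rfl | hu1
  -- At `u = 1` the numerator and the denominator are both `4 - x²`, and the density is minus the
  -- arcsine density. The endpoints, where the quotient is `0/0`, are removed.
  · rw [integrableOn_Icc_iff_integrableOn_Ioo]
    have h : IntegrableOn (fun x : ℝ => (√(4 - x ^ 2))⁻¹ • (-(1 / π))) (Icc (-2 : ℝ) 2) :=
      integrableOn_arcsine_of_continuousOn continuousOn_const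
    refine (h.mono_set Ioo_subset_Icc_self).congr_fun ?_ measurableSet_Ioo
    intro x hx
    have hD : lambdaDenom 1 x ≠ 0 := by
      rw [lambdaDenom]
      have : x ^ 2 < 4 := by nlinarith [hx.1, hx.2]
      intro h; linarith
    have hN : (2 * 1 ^ 4 + 2 * 1 ^ 2 - 1 ^ 2 * x ^ 2) / lambdaDenom 1 x = 1 := by
      rw [div_eq_one_iff_eq hD, lambdaDenom]; ring
    simp only [hN, mul_one]
  · apply integrableOn_arcsine_of_continuousOn
    exact continuousOn_const.mul (ContinuousOn.div (by fun_prop)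
      (continuous_lambdaDenom u).continuousOn (fun x hx => (lambdaDenom_pos hu hu1 hx).ne'))

/-- The root of modulus `< 1` of `q + q⁻¹ = u + u⁻¹`. -/
lemma exists_root_add_inv {u : ℝ} (hu : 0 < u) (hu1 : u ≠ 1) : ∃ q : ℝ, 0 < q ∧ q < 1 ∧
    q + q⁻¹ = u + u⁻¹ ∧
    (1 - u ^ 4) / u ^ 2 * (q / (1 - q ^ 2)) = if 1 ≤ u then -(u + u⁻¹) else u + u⁻¹ := by
  -- The small root passes from `u` to `u⁻¹` as `u` crosses `1`, which flips the sign in the last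
  -- identity; the atoms of `Λ_u` compensate this flip.
  rcases lt_or_gt_of_ne hu1 with h | h
  · refine ⟨u, hu, h, rfl, ?_⟩
    rw [if_neg (not_le.2 h)]
    have : 1 - u ^ 2 ≠ 0 := by nlinarith
    field_simp
    ring
  · refine ⟨u⁻¹, inv_pos.2 hu, inv_lt_one_of_one_lt₀ h, by rw [inv_inv, add_comm], ?_⟩
    rw [if_pos h.le]
    have : u ^ 2 - 1 ≠ 0 := by nlinarith
    have h2 : 1 - u⁻¹ ^ 2 = (u ^ 2 - 1) / u ^ 2 := by field_simp
    rw [h2]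
    field_simp
    ring

lemma norm_ofReal_lt_one {q : ℝ} (h0 : 0 < q) (h1 : q < 1) : ‖(q : ℂ)‖ < 1 := by
  rwa [Complex.norm_real, Real.norm_eq_abs, abs_of_pos h0]

lemma neg_add_neg_inv (q : ℂ) : -q + (-q)⁻¹ = -(q + q⁻¹) := by rw [inv_neg]; ring

/-- Partial fractions at `±(u + u⁻¹)`. The value does not depend on `u`: the blow-up of `1 /
lambdaDenom` near `u = 1` is offset by the factor `|1 - u⁴|`, so the variation of `Λ_u` stays
bounded there. -/
lemma integral_arcsine_inv_lambdaDenom {u : ℝ} (hu : 0 < u) (hu1 : u ≠ 1) :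
    ∫ x in Icc (-2 : ℝ) 2, (√(4 - x ^ 2))⁻¹ • (|1 - u ^ 4| / lambdaDenom u x) = π := by
  obtain ⟨q, hq0, hq1, hqa, hq⟩ := exists_root_add_inv hu hu1
  have hqn := norm_ofReal_lt_one hq0 hq1
  have hqc : (q : ℂ) ≠ 0 := by exact_mod_cast hq0.ne'
  have hqn' : ‖-(q : ℂ)‖ < 1 := by rwa [norm_neg]
  set a := u + u⁻¹ with ha
  have ha0 : 0 < a := by positivity
  have hqa' : (q : ℂ) + (q : ℂ)⁻¹ = (a : ℂ) := by exact_mod_cast hqa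
  have h1 := integral_arcsine_inv_sub hqn hqc
  have h2 := integral_arcsine_inv_sub hqn' (neg_ne_zero.2 hqc)
  have i1 := integrableOn_arcsine_inv_sub hqn hqc
  have i2 := integrableOn_arcsine_inv_sub hqn' (neg_ne_zero.2 hqc)
  rw [neg_add_neg_inv] at h2 i2
  rw [hqa'] at h1 h2 i1 i2
  have hpt : EqOn (fun x : ℝ => (((√(4 - x ^ 2))⁻¹ • (|1 - u ^ 4| / lambdaDenom u x) : ℝ) : ℂ))
      (fun x : ℝ => ((|1 - u ^ 4| / (u ^ 2 * (2 * a)) : ℝ) : ℂ) *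
        ((√(4 - x ^ 2))⁻¹ • ((a : ℂ) - x)⁻¹ - (√(4 - x ^ 2))⁻¹ • (-(a : ℂ) - x)⁻¹))
      (Icc (-2 : ℝ) 2) := by
    intro x hx
    have hD := lambdaDenom_pos hu hu1 hx
    simp only
    rw [lambdaDenom_eq hu, ← ha] at hD ⊢
    have e1 : a - x ≠ 0 := by rintro h; simp [h] at hD
    have e2 : a + x ≠ 0 := by rintro h; simp [h] at hD
    have e3 : -a - x ≠ 0 := fun h => e2 (by linarith)
    simp only [smul_eq_mul, Complex.real_smul]
    norm_cast
    rw [show -a - x = -(a + x) by ring, inv_neg]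
    field_simp
    ring
  apply Complex.ofReal_injective
  rw [← integral_complex_ofReal, setIntegral_congr_fun measurableSet_Icc hpt, integral_const_mul,
    integral_sub i1 i2, h1, h2]
  have hq2 : 0 < 1 - q ^ 2 := by nlinarith
  have key : |1 - u ^ 4| / (u ^ 2 * (2 * a)) * (π * (q / (1 - q ^ 2)) - π * (-q / (1 - q ^ 2))) =
      π := by
    have h5 : |1 - u ^ 4| / u ^ 2 * (q / (1 - q ^ 2)) = a := by
      have := congrArg abs hq
      rw [abs_mul, abs_div, abs_of_pos (show 0 < q / (1 - q ^ 2) by positivity),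
        abs_of_pos (show 0 < u ^ 2 by positivity)] at this
      rw [this]
      split_ifs
      · rw [abs_neg, abs_of_pos ha0]
      · rw [abs_of_pos ha0]
    calc _ = π * (|1 - u ^ 4| / u ^ 2 * (q / (1 - q ^ 2))) / a := by field_simp; ring
      _ = π := by rw [h5]; field_simp
  rw [neg_sq]
  exact_mod_cast key

lemma integral_arcsine_one_real : ∫ x in Icc (-2 : ℝ) 2, (√(4 - x ^ 2))⁻¹ • (1 : ℝ) = π := by
  rw [integral_arcsine]; simp

/-- The two terms of `lambdaDensity_eq'` have mass `1` each in absolute value. -/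
lemma integral_abs_lambdaDensity_le_two {u : ℝ} (hu : 0 < u) (hu1 : u ≠ 1) :
    ∫ x in Icc (-2 : ℝ) 2, |lambdaDensity u x| ≤ 2 := by
  have i1 : IntegrableOn (fun x : ℝ => (√(4 - x ^ 2))⁻¹ • (1 : ℝ)) (Icc (-2 : ℝ) 2) :=
    integrableOn_arcsine_of_continuousOn continuousOn_const
  have i2 : IntegrableOn (fun x : ℝ => (√(4 - x ^ 2))⁻¹ • (|1 - u ^ 4| / lambdaDenom u x))
      (Icc (-2 : ℝ) 2) := by
    apply integrableOn_arcsine_of_continuousOn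
    exact ContinuousOn.div continuousOn_const
      (continuous_lambdaDenom u).continuousOn (fun x hx => (lambdaDenom_pos hu hu1 hx).ne')
  have h : ∀ x ∈ Icc (-2 : ℝ) 2, |lambdaDensity u x| ≤ (1 / π) *
      ((√(4 - x ^ 2))⁻¹ • (1 : ℝ) + (√(4 - x ^ 2))⁻¹ • (|1 - u ^ 4| / lambdaDenom u x)) := by
    intro x hx
    have hD := lambdaDenom_pos hu hu1 hx
    rw [lambdaDensity_eq' hD.ne', smul_eq_mul, abs_mul, abs_mul, abs_neg,
      abs_of_pos (show 0 < 1 / π by positivity), abs_of_nonneg (show 0 ≤ (√(4 - x ^ 2))⁻¹ by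
        positivity), ← smul_add, smul_eq_mul, ← mul_assoc, mul_comm _ (1 / π), mul_assoc]
    have := abs_sub (1 : ℝ) ((1 - u ^ 4) / lambdaDenom u x)
    rw [abs_one, abs_div, abs_of_pos hD] at this
    gcongr
  refine (setIntegral_mono_on (integrableOn_lambdaDensity hu).abs ((i1.add i2).const_mul _)
    measurableSet_Icc h).trans ?_
  rw [integral_const_mul]
  simp only [Pi.add_apply]
  rw [integral_add i1 i2, integral_arcsine_one_real, integral_arcsine_inv_lambdaDenom hu hu1]
  field_simp
  norm_num

/-- The numerator is at most `3u²` in absolute value and the denominator at least `1/4`. The factor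
`u²` is what tames `u^(-1-α)` at the origin. -/
lemma integral_abs_lambdaDensity_le_sq {u : ℝ} (hu : 0 < u) (hu2 : u ^ 2 ≤ 1 / 2) :
    ∫ x in Icc (-2 : ℝ) 2, |lambdaDensity u x| ≤ 12 * u ^ 2 := by
  have i1 : IntegrableOn (fun x : ℝ => (√(4 - x ^ 2))⁻¹ • (1 : ℝ)) (Icc (-2 : ℝ) 2) :=
    integrableOn_arcsine_of_continuousOn continuousOn_const
  have h : ∀ x ∈ Icc (-2 : ℝ) 2, |lambdaDensity u x| ≤ (12 * u ^ 2 / π) *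
      ((√(4 - x ^ 2))⁻¹ • (1 : ℝ)) := by
    intro x hx
    have hD : 1 / 4 ≤ lambdaDenom u x :=
      le_trans (by nlinarith) (sq_one_sub_sq_le_lambdaDenom u hx)
    have hx2 : x ^ 2 ≤ 4 := by nlinarith [hx.1, hx.2]
    have hN : |(2 * u ^ 4 + 2 * u ^ 2 - u ^ 2 * x ^ 2) / lambdaDenom u x| ≤ 12 * u ^ 2 := by
      rw [abs_div, abs_of_pos (by linarith : 0 < lambdaDenom u x), div_le_iff₀ (by linarith)]
      have : |2 * u ^ 4 + 2 * u ^ 2 - u ^ 2 * x ^ 2| ≤ 3 * u ^ 2 := by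
        rw [abs_le]
        constructor <;> nlinarith [sq_nonneg u, sq_nonneg x, mul_nonneg (sq_nonneg u) (sq_nonneg x)]
      nlinarith [sq_nonneg u]
    rw [lambdaDensity_eq, smul_eq_mul, abs_mul, abs_mul, abs_neg,
      abs_of_pos (show 0 < 1 / π by positivity), abs_of_nonneg (show 0 ≤ (√(4 - x ^ 2))⁻¹ by
        positivity), smul_eq_mul, mul_one]
    calc _ ≤ (√(4 - x ^ 2))⁻¹ * (1 / π * (12 * u ^ 2)) := by gcongr
      _ = _ := by ring
  refine (setIntegral_mono_on (integrableOn_lambdaDensity hu).abs (i1.const_mul _)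
    measurableSet_Icc h).trans ?_
  rw [integral_const_mul, integral_arcsine_one_real]
  field_simp
  exact le_rfl

/-- The measure carrying `Λ_u`. -/
def lambdaBase (u : ℝ) : Measure ℝ := volume.restrict (Icc (-2 : ℝ) 2) +
  if 1 ≤ u then Measure.dirac (u + u⁻¹) + Measure.dirac (-u - u⁻¹) else 0

/-- The density of `Λ_u` with respect to `lambdaBase u`. -/
def lambdaWeight (u x : ℝ) : ℝ := if x ∈ Icc (-2 : ℝ) 2 then lambdaDensity u x else 1

instance (u : ℝ) : IsFiniteMeasure (lambdaBase u) := by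
  unfold lambdaBase
  split_ifs <;> infer_instance

lemma measurable_lambdaDensity (u : ℝ) : Measurable (lambdaDensity u) := by
  unfold lambdaDensity; fun_prop

lemma measurable_lambdaWeight (u : ℝ) : Measurable (lambdaWeight u) :=
  Measurable.ite measurableSet_Icc (measurable_lambdaDensity u) measurable_const

lemma two_lt_add_inv {u : ℝ} (hu : 0 < u) (hu1 : u ≠ 1) : 2 < u + u⁻¹ := by
  have h : 0 < (u - 1) ^ 2 := by have := sub_ne_zero.2 hu1; positivity
  have : u + u⁻¹ - 2 = (u - 1) ^ 2 / u := by field_simp; ring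
  have h2 : 0 < (u - 1) ^ 2 / u := by positivity
  linarith

/-- Needs `u ≠ 1`: at `u = 1` the atoms fall on the endpoints `±2`, where `lambdaWeight` takes the
value of the density instead of `1`. -/
lemma lambdaWeight_add_inv {u : ℝ} (hu : 0 < u) (hu1 : u ≠ 1) :
    lambdaWeight u (u + u⁻¹) = 1 ∧ lambdaWeight u (-u - u⁻¹) = 1 := by
  have := two_lt_add_inv hu hu1
  constructor
  · rw [lambdaWeight, if_neg]; rintro ⟨-, h⟩; linarith
  · rw [lambdaWeight, if_neg]; rintro ⟨h, -⟩; linarith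

section
variable {E : Type*} [NormedAddCommGroup E]

lemma integrable_lambdaBase {u : ℝ} {f : ℝ → E} (hf : StronglyMeasurable f)
    (hi : IntegrableOn f (Icc (-2) 2)) : Integrable f (lambdaBase u) := by
  unfold lambdaBase
  refine Integrable.add_measure hi ?_
  split_ifs
  · exact (integrable_dirac' hf (by simp)).add_measure (integrable_dirac' hf (by simp))
  · exact integrable_zero_measure

lemma integral_lambdaBase [NormedSpace ℝ E] [CompleteSpace E] {u : ℝ} {f : ℝ → E}
    (hf : StronglyMeasurable f) (hi : IntegrableOn f (Icc (-2) 2)) :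
    ∫ x, f x ∂(lambdaBase u) = (∫ x in Icc (-2 : ℝ) 2, f x) +
      if 1 ≤ u then f (u + u⁻¹) + f (-u - u⁻¹) else 0 := by
  unfold lambdaBase
  split_ifs
  · rw [integral_add_measure hi ((integrable_dirac' hf (by simp)).add_measure
      (integrable_dirac' hf (by simp))), integral_add_measure (integrable_dirac' hf (by simp))
      (integrable_dirac' hf (by simp)), integral_dirac' _ _ hf, integral_dirac' _ _ hf]
  · rw [add_zero, add_zero]

end

lemma integrable_lambdaWeight {u : ℝ} (hu : 0 < u) : Integrable (lambdaWeight u) (lambdaBase u) :=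
  integrable_lambdaBase (measurable_lambdaWeight u).stronglyMeasurable
    ((integrableOn_lambdaDensity hu).congr_fun
      (fun x hx => by rw [lambdaWeight, if_pos hx]) measurableSet_Icc)

/-- The total variation bound behind every domination involving `Λ_u`. For `u² > 1/2` the right side
is at least `6`, while density and atoms contribute at most `2 + 2`. -/
lemma integral_abs_lambdaWeight_le {u : ℝ} (hu : 0 < u) (hu1 : u ≠ 1) :
    ∫ x, |lambdaWeight u x| ∂(lambdaBase u) ≤ 12 * min 1 (u ^ 2) := by
  obtain ⟨e1, e2⟩ := lambdaWeight_add_inv hu hu1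
  have hc : EqOn (fun x => |lambdaDensity u x|) (fun x => |lambdaWeight u x|) (Icc (-2) 2) :=
    fun x hx => by simp only; rw [lambdaWeight, if_pos hx]
  rw [integral_lambdaBase (measurable_lambdaWeight u).abs.stronglyMeasurable
    (IntegrableOn.congr_fun (integrableOn_lambdaDensity hu).abs hc measurableSet_Icc),
    ← setIntegral_congr_fun measurableSet_Icc hc, e1, e2]
  rcases le_or_gt (u ^ 2) (1 / 2) with h | h
  · have h1 : ¬ (1 ≤ u) := fun h1 => by nlinarith
    rw [if_neg h1, min_eq_right (by linarith), add_zero]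
    exact integral_abs_lambdaDensity_le_sq hu h
  · have h3 : 1 / 2 ≤ min 1 (u ^ 2) := le_min (by norm_num) h.le
    have h4 := integral_abs_lambdaDensity_le_two hu hu1
    split_ifs
    · norm_num; linarith
    · linarith

lemma integrable_lambdaWeight_mul {u : ℝ} (hu : 0 < u) {ψ : ℝ → ℂ} (hψ : Measurable ψ) {B : ℝ}
    (hB : ∀ x, ‖ψ x‖ ≤ B) :
    Integrable (fun x => (lambdaWeight u x : ℂ) * ψ x) (lambdaBase u) :=
  (integrable_lambdaWeight hu).ofReal.mul_bdd hψ.aestronglyMeasurable (Eventually.of_forall hB)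

lemma lambdaApply_eq {u : ℝ} (hu : 0 < u) (hu1 : u ≠ 1) {ψ : ℝ → ℂ} (hψ : Measurable ψ) {B : ℝ}
    (hB : ∀ x, ‖ψ x‖ ≤ B) :
    lambdaApply u ψ = ∫ x, (lambdaWeight u x : ℂ) * ψ x ∂(lambdaBase u) := by
  obtain ⟨e1, e2⟩ := lambdaWeight_add_inv hu hu1
  have hc : EqOn (fun x => (lambdaDensity u x : ℂ) * ψ x)
      (fun x => (lambdaWeight u x : ℂ) * ψ x) (Icc (-2) 2) :=
    fun x hx => by simp only; rw [lambdaWeight, if_pos hx]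
  have hm : Measurable fun x => (lambdaWeight u x : ℂ) * ψ x :=
    (Complex.measurable_ofReal.comp (measurable_lambdaWeight u)).mul hψ
  rw [integral_lambdaBase hm.stronglyMeasurable, ← setIntegral_congr_fun measurableSet_Icc hc,
    lambdaApply, e1, e2]
  · simp
  · refine IntegrableOn.congr_fun ?_ hc measurableSet_Icc
    exact (integrableOn_lambdaDensity hu).ofReal.mul_bdd hψ.aestronglyMeasurable
      (Eventually.of_forall hB)

lemma norm_lambdaApply_le {u : ℝ} (hu : 0 < u) (hu1 : u ≠ 1) {ψ : ℝ → ℂ} (hψ : Measurable ψ)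
    {B : ℝ} (hB : ∀ x, ‖ψ x‖ ≤ B) : ‖lambdaApply u ψ‖ ≤ 12 * min 1 (u ^ 2) * B := by
  rw [lambdaApply_eq hu hu1 hψ hB]
  have hB0 : 0 ≤ B := (norm_nonneg _).trans (hB 0)
  calc _ ≤ ∫ x, |lambdaWeight u x| * B ∂(lambdaBase u) := by
        refine norm_integral_le_of_norm_le ((integrable_lambdaWeight hu).abs.mul_const B) ?_
        refine Eventually.of_forall fun x => ?_
        rw [norm_mul, Complex.norm_real, Real.norm_eq_abs]
        exact mul_le_mul_of_nonneg_left (hB x) (abs_nonneg _)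
    _ = (∫ x, |lambdaWeight u x| ∂(lambdaBase u)) * B := integral_mul_const _ _
    _ ≤ _ := mul_le_mul_of_nonneg_right (integral_abs_lambdaWeight_le hu hu1) hB0

/-- `Λ_u` applied to `x ↦ (z - x)⁻¹`. -/
def lambdaResolvent (u : ℝ) (z : ℂ) : ℂ :=
  2 * (u : ℂ) ^ 2 * semicircleStieltjes z ^ 3 /
    ((1 - semicircleStieltjes z ^ 2) * (1 - (u : ℂ) ^ 2 * semicircleStieltjes z ^ 2))

lemma sub_ofReal_ne_zero {z : ℂ} (hz : z.im ≠ 0) (x : ℝ) : z - (x : ℂ) ≠ 0 := by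
  intro h
  apply hz
  rw [sub_eq_zero.1 h, Complex.ofReal_im]

/-- Partial fractions reduce the integral to arcsine transforms at `z` and at `±a`, where `a = u +
u⁻¹`. The sign change of the `±a` contribution at `u = 1` is made up by the two atoms, so one
formula covers both ranges of `u`. -/
lemma lambdaApply_resolvent {u : ℝ} (hu : 0 < u) (hu1 : u ≠ 1) {z : ℂ} (hz : z.im ≠ 0) :
    lambdaApply u (fun x : ℝ => (z - (x : ℂ))⁻¹) = lambdaResolvent u z := by
  obtain ⟨q, hq0, hq1, hqa, hq⟩ := exists_root_add_inv hu hu1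
  obtain ⟨hm1, hm0, hmz⟩ := semicircleStieltjes_spec hz
  rw [lambdaResolvent]
  generalize semicircleStieltjes z = m at *
  have hqn := norm_ofReal_lt_one hq0 hq1
  have hqc : (q : ℂ) ≠ 0 := by exact_mod_cast hq0.ne'
  have hqn' : ‖-(q : ℂ)‖ < 1 := by rwa [norm_neg]
  set a := u + u⁻¹ with ha
  have ha0 : 0 < a := by positivity
  have hac : (a : ℂ) ≠ 0 := by exact_mod_cast ha0.ne'
  have huc : (u : ℂ) ≠ 0 := by exact_mod_cast hu.ne'
  have hqa' : (q : ℂ) + (q : ℂ)⁻¹ = (a : ℂ) := by exact_mod_cast hqa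
  have h1 := integral_arcsine_inv_sub hqn hqc
  have h2 := integral_arcsine_inv_sub hqn' (neg_ne_zero.2 hqc)
  have h3 := integral_arcsine_inv_sub hm1 hm0
  have i1 := integrableOn_arcsine_inv_sub hqn hqc
  have i2 := integrableOn_arcsine_inv_sub hqn' (neg_ne_zero.2 hqc)
  have i3 := integrableOn_arcsine_inv_sub hm1 hm0
  rw [neg_add_neg_inv] at h2 i2
  rw [hqa'] at h1 h2 i1 i2
  rw [hmz] at h3 i3
  have hza : z - a ≠ 0 := sub_ofReal_ne_zero hz a
  have hza' : z + a ≠ 0 := by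
    have := sub_ofReal_ne_zero hz (-a)
    rwa [Complex.ofReal_neg, sub_neg_eq_add] at this
  have hza2 : z ^ 2 - (a : ℂ) ^ 2 ≠ 0 := by
    rw [sq_sub_sq]; exact mul_ne_zero hza' hza
  set c : ℂ := (1 - (u : ℂ) ^ 4) / (u : ℂ) ^ 2 with hc
  have hpt : EqOn (fun x : ℝ => (lambdaDensity u x : ℂ) * (z - (x : ℂ))⁻¹)
      (fun x : ℝ => (-(π : ℂ)⁻¹) * ((1 + c / (z ^ 2 - (a : ℂ) ^ 2)) *
        ((√(4 - x ^ 2))⁻¹ • (z - (x : ℂ))⁻¹) +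
        (-(c / (2 * a * (z - a))) * ((√(4 - x ^ 2))⁻¹ • ((a : ℂ) - x)⁻¹) +
        c / (2 * a * (z + a)) * ((√(4 - x ^ 2))⁻¹ • (-(a : ℂ) - x)⁻¹))))
      (Icc (-2 : ℝ) 2) := by
    intro x hx
    have hD := lambdaDenom_pos hu hu1 hx
    simp only
    rw [lambdaDensity_eq' hD.ne']
    rw [lambdaDenom_eq hu, ← ha] at hD ⊢
    have e1 : (a : ℂ) - x ≠ 0 := by
      intro h; rw [← Complex.ofReal_sub, Complex.ofReal_eq_zero] at h; simp [h] at hD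
    have e2 : (a : ℂ) + x ≠ 0 := by
      intro h; rw [← Complex.ofReal_add, Complex.ofReal_eq_zero] at h; simp [h] at hD
    have e3 : z - (x : ℂ) ≠ 0 := sub_ofReal_ne_zero hz x
    rw [show -(a : ℂ) - x = -(a + x) by ring, inv_neg]
    simp only [smul_eq_mul, Complex.real_smul]
    push_cast
    rw [hc]
    have hkey : ((a : ℂ) - x)⁻¹ * ((a : ℂ) + x)⁻¹ * (z - x)⁻¹ =
        -(z ^ 2 - (a : ℂ) ^ 2)⁻¹ * (z - x)⁻¹ + (2 * a * (z - a))⁻¹ * ((a : ℂ) - x)⁻¹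
          + (2 * a * (z + a))⁻¹ * ((a : ℂ) + x)⁻¹ := by
      have : z ^ 2 - (a : ℂ) ^ 2 = (z + a) * (z - a) := by ring
      rw [this]
      field_simp
      ring
    simp only [div_eq_mul_inv, mul_inv] at hkey ⊢
    linear_combination ((√(4 - x ^ 2) : ℝ) : ℂ)⁻¹ * (π : ℂ)⁻¹ * (1 - (u : ℂ) ^ 4) *
      ((u : ℂ) ^ 2)⁻¹ * hkey
  rw [lambdaApply, setIntegral_congr_fun measurableSet_Icc hpt, integral_const_mul,
    integral_add (i3.const_mul _) (show Integrable (fun x : ℝ =>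
      -(c / (2 * a * (z - a))) * ((√(4 - x ^ 2))⁻¹ • ((a : ℂ) - x)⁻¹) +
        c / (2 * a * (z + a)) * ((√(4 - x ^ 2))⁻¹ • (-(a : ℂ) - x)⁻¹))
        (volume.restrict (Icc (-2) 2)) from (i1.const_mul _).add (i2.const_mul _)),
    integral_add (i1.const_mul _) (i2.const_mul _), integral_const_mul, integral_const_mul,
    integral_const_mul, h1, h2, h3]
  have hpi : (π : ℂ) ≠ 0 := by exact_mod_cast Real.pi_ne_zero
  have hm2 := one_sub_sq_ne_zero hm1
  have hq' : c * ((q : ℂ) / (1 - (q : ℂ) ^ 2)) = if 1 ≤ u then -(a : ℂ) else a := by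
    have h := congrArg (fun x : ℝ => (x : ℂ)) hq
    push_cast at h
    rw [hc, h]
    split_ifs <;> simp
  -- The atoms contribute `2z/(z² - a²)` and the poles of the density `-z/(z² - a²)` when `u > 1`;
  -- when `u < 1` the poles alone contribute `+z/(z² - a²)`.
  have hbr : (if 1 ≤ u then (z - ((a : ℝ) : ℂ))⁻¹ + (z - ((-u - u⁻¹ : ℝ) : ℂ))⁻¹ else 0)
      + c * ((q : ℂ) / (1 - (q : ℂ) ^ 2)) * (z / (a * (z ^ 2 - (a : ℂ) ^ 2))) =
      z / (z ^ 2 - (a : ℂ) ^ 2) := by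
    rw [hq', show -u - u⁻¹ = -a by rw [ha]; ring, Complex.ofReal_neg, sub_neg_eq_add]
    have : z ^ 2 - (a : ℂ) ^ 2 = (z + a) * (z - a) := by ring
    rw [this]
    split_ifs
    · field_simp; ring
    · field_simp; ring
  -- In terms of `m` the poles become explicit; the factor `u² - m²` cancels in the final
  -- expression.
  have hfac : (z ^ 2 - (a : ℂ) ^ 2) * m ^ 2 * (u : ℂ) ^ 2 =
      (1 - (u : ℂ) ^ 2 * m ^ 2) * ((u : ℂ) ^ 2 - m ^ 2) := by
    rw [← hmz, ha]; push_cast; field_simp; ring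
  have hne : (1 - (u : ℂ) ^ 2 * m ^ 2) * ((u : ℂ) ^ 2 - m ^ 2) ≠ 0 := by
    rw [← hfac]; positivity
  have hn1 := left_ne_zero_of_mul hne
  have hn2 := right_ne_zero_of_mul hne
  have hza3 : z ^ 2 - (a : ℂ) ^ 2 = (1 - (u : ℂ) ^ 2 * m ^ 2) * ((u : ℂ) ^ 2 - m ^ 2) /
      (m ^ 2 * (u : ℂ) ^ 2) := by
    rw [eq_div_iff (by positivity), ← hfac]; ring
  have hpart : -(π : ℂ)⁻¹ * ((1 + c / (z ^ 2 - (a : ℂ) ^ 2)) * (π * (m / (1 - m ^ 2))) +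
      (-(c / (2 * a * (z - a))) * (π * (q / (1 - (q : ℂ) ^ 2))) +
        c / (2 * a * (z + a)) * (π * (-q / (1 - (-(q : ℂ)) ^ 2))))) =
      -(m / (1 - m ^ 2)) - c * m / ((1 - m ^ 2) * (z ^ 2 - (a : ℂ) ^ 2)) +
      c * ((q : ℂ) / (1 - (q : ℂ) ^ 2)) * (z / (a * (z ^ 2 - (a : ℂ) ^ 2))) := by
    rw [neg_sq]
    have h6 : 1 - (q : ℂ) ^ 2 ≠ 0 := one_sub_sq_ne_zero hqn
    have : z ^ 2 - (a : ℂ) ^ 2 = (z + a) * (z - a) := by ring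
    rw [this]
    field_simp
    ring
  rw [hpart, add_assoc, add_comm (c * _ * _), hbr, hza3, hc, ← hmz]
  clear hne hza3 hfac
  generalize hp : 1 - (u : ℂ) ^ 2 * m ^ 2 = p at *
  field_simp
  rw [← hp]
  ring

/-! ### Laplace transforms and powers -/

lemma norm_exp_neg_mul (r : ℝ) (x : ℂ) : ‖Complex.exp (-((r : ℂ) * x))‖ = rexp (-(r * x.re)) := by
  rw [Complex.norm_exp]; simp

lemma norm_exp_neg_le_one {w : ℂ} (hw : 0 ≤ w.re) : ‖Complex.exp (-w)‖ ≤ 1 := by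
  rw [Complex.norm_exp, Real.exp_le_one_iff]; simpa using hw

lemma norm_one_sub_exp_neg_le {w : ℂ} (hw : 0 ≤ w.re) :
    ‖1 - Complex.exp (-w)‖ ≤ 2 * min 1 ‖w‖ := by
  rw [mul_min_of_nonneg _ _ zero_le_two, le_min_iff]
  have h2 : ‖1 - Complex.exp (-w)‖ ≤ 2 := by
    have := norm_sub_le 1 (Complex.exp (-w))
    have := norm_exp_neg_le_one hw
    rw [norm_one] at *
    linarith
  refine ⟨by linarith, ?_⟩
  rcases le_or_gt ‖w‖ 1 with h | h
  · have := Complex.norm_exp_sub_one_le (x := -w) (by rwa [norm_neg])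
    rwa [norm_neg, norm_sub_rev] at this
  · linarith

lemma min_one_mul_le {r a : ℝ} (hr : 0 ≤ r) (ha : 0 ≤ a) : min 1 (r * a) ≤ (1 + a) * min 1 r := by
  rcases le_total 1 r with h | h
  · rw [min_eq_left h]
    exact (min_le_left _ _).trans (by linarith)
  · rw [min_eq_right h]
    exact (min_le_right _ _).trans (by nlinarith)

lemma norm_one_sub_exp_neg_mul_le {r : ℝ} (hr : 0 ≤ r) {x : ℂ} (hx : 0 ≤ x.re) :
    ‖1 - Complex.exp (-((r : ℂ) * x))‖ ≤ 2 * (1 + ‖x‖) * min 1 r := by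
  have h1 := norm_one_sub_exp_neg_le (w := (r : ℂ) * x)
    (by simpa using mul_nonneg hr hx)
  rw [norm_mul, Complex.norm_real, Real.norm_of_nonneg hr] at h1
  have := min_one_mul_le hr (norm_nonneg x)
  linarith

/-- Applied with `n = 1`, `γ = α/2` to the variable `r`, and with `n = 2`, `γ = α` to `u`, where `r
= u²`. -/
lemma integrableOn_min_sq_mul_rpow {n : ℕ} {γ : ℝ} (h0 : 0 < γ) (hγ : γ < 2 * n) :
    IntegrableOn (fun r : ℝ => (min 1 (r ^ n)) ^ 2 * r ^ (-γ - 1)) (Ioi 0) := by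
  rw [← Ioc_union_Ioi_eq_Ioi zero_le_one]
  refine IntegrableOn.union ?_ ?_
  · have h := (intervalIntegral.intervalIntegrable_rpow' (a := 0) (b := 1)
      (r := 2 * n - γ - 1) (by linarith)).1
    refine h.congr_fun ?_ measurableSet_Ioc
    intro r hr
    simp only
    rw [min_eq_right (pow_le_one₀ hr.1.le hr.2), ← pow_mul, ← Real.rpow_natCast r (n * 2),
      ← Real.rpow_add hr.1]
    congr 1; push_cast; ring
  · refine (integrableOn_Ioi_rpow_of_lt (a := -γ - 1) (by linarith) one_pos).congr_fun ?_
      measurableSet_Ioi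
    intro r hr
    simp only
    rw [min_eq_left (one_le_pow₀ (le_of_lt hr)), one_pow, one_mul]

/-- Differentiation of a (regularized) Laplace transform. -/
lemma hasDerivAt_integral_mul_sub_exp {h : ℝ → ℂ} (c : ℂ) {x : ℂ} (hx : 0 < x.re)
    (hm : AEStronglyMeasurable h (volume.restrict (Ioi 0)))
    (hi : IntegrableOn (fun r : ℝ => h r * (c - Complex.exp (-((r : ℂ) * x)))) (Ioi 0))
    (hb : ∀ b : ℝ, 0 < b → IntegrableOn (fun r : ℝ => r * ‖h r‖ * rexp (-(r * b))) (Ioi 0)) :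
    HasDerivAt (fun y : ℂ => ∫ r in Ioi (0 : ℝ), h r * (c - Complex.exp (-((r : ℂ) * y))))
      (∫ r in Ioi (0 : ℝ), h r * (r * Complex.exp (-((r : ℂ) * x)))) x := by
  -- Differentiation takes place on the half plane `Re y > Re x / 2`, where the exponential has a
  -- uniform majorant.
  have hs : {y : ℂ | x.re / 2 < y.re} ∈ 𝓝 x :=
    (Complex.continuous_re.isOpen_preimage _ isOpen_Ioi).mem_nhds
      (show x.re / 2 < x.re by linarith)
  refine (hasDerivAt_integral_of_dominated_loc_of_deriv_le
    (F := fun (y : ℂ) (r : ℝ) => h r * (c - Complex.exp (-((r : ℂ) * y))))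
    (F' := fun (y : ℂ) (r : ℝ) => h r * (r * Complex.exp (-((r : ℂ) * y))))
    (bound := fun r : ℝ => r * ‖h r‖ * rexp (-(r * (x.re / 2)))) hs ?_ hi ?_ ?_
    (hb _ (by linarith)) ?_).2
  · refine Eventually.of_forall fun y => hm.mul ?_
    exact (by fun_prop : Continuous fun r : ℝ =>
      c - Complex.exp (-((r : ℂ) * y))).aestronglyMeasurable
  · exact hm.mul (by fun_prop : Continuous fun r : ℝ =>
      (r : ℂ) * Complex.exp (-((r : ℂ) * x))).aestronglyMeasurable
  · refine (ae_restrict_iff' measurableSet_Ioi).2 (Eventually.of_forall fun r hr y hy => ?_)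
    have hr' : 0 < r := hr
    rw [norm_mul, norm_mul, norm_exp_neg_mul, Complex.norm_real, Real.norm_of_nonneg hr'.le]
    rw [← mul_assoc, mul_comm ‖h r‖]
    have : x.re / 2 < y.re := hy
    gcongr
  · refine Eventually.of_forall fun r y _ => ?_
    have h1 : HasDerivAt (fun y : ℂ => -((r : ℂ) * y)) (-((r : ℂ) * 1)) y :=
      ((hasDerivAt_id y).const_mul _).neg
    have h2 := (h1.cexp.const_sub c).const_mul (h r)
    refine h2.congr_deriv ?_
    ring

lemma integrableOn_rpow_mul_exp_neg_mul {s b : ℝ} (hs : -1 < s) (hb : 0 < b) :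
    IntegrableOn (fun r : ℝ => r ^ s * rexp (-(r * b))) (Ioi 0) := by
  have := integrableOn_rpow_mul_exp_neg_mul_rpow hs one_pos hb
  refine this.congr_fun (fun r hr => ?_) measurableSet_Ioi
  simp only
  rw [Real.rpow_one]
  ring_nf

lemma integrableOn_rpow_mul_cexp_neg_mul {s : ℝ} (hs : -1 < s) {x : ℂ} (hx : 0 < x.re) :
    IntegrableOn (fun r : ℝ => ((r ^ s : ℝ) : ℂ) * Complex.exp (-((r : ℂ) * x))) (Ioi 0) := by
  refine Integrable.mono' (integrableOn_rpow_mul_exp_neg_mul hs hx) ?_ ?_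
  · exact (Measurable.aestronglyMeasurable (by fun_prop))
  · refine (ae_restrict_iff' measurableSet_Ioi).2 (Eventually.of_forall fun r hr => ?_)
    rw [norm_mul, norm_exp_neg_mul, Complex.norm_real,
      Real.norm_of_nonneg (Real.rpow_nonneg (le_of_lt hr) _)]

/-- Euler's integral for real `x`, extended by the identity theorem: both sides are holomorphic in
the right half plane and agree at the points `1 + 1/(n+1)`, which accumulate at `1`. -/
lemma integral_rpow_mul_cexp_neg_mul {a : ℝ} (ha : 0 < a) {x : ℂ} (hx : 0 < x.re) :
    ∫ r in Ioi (0 : ℝ), ((r ^ (a - 1) : ℝ) : ℂ) * Complex.exp (-((r : ℂ) * x)) =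
      Real.Gamma a * x ^ (-a : ℂ) := by
  set U : Set ℂ := {y : ℂ | 0 < y.re} with hU
  have hUo : IsOpen U := Complex.continuous_re.isOpen_preimage _ isOpen_Ioi
  have hf : AnalyticOnNhd ℂ (fun x : ℂ => ∫ r in Ioi (0 : ℝ),
      ((r ^ (a - 1) : ℝ) : ℂ) * Complex.exp (-((r : ℂ) * x))) U := by
    refine DifferentiableOn.analyticOnNhd (fun y hy => ?_) hUo
    have hy' : 0 < y.re := hy
    have := hasDerivAt_integral_mul_sub_exp (h := fun r : ℝ => ((r ^ (a - 1) : ℝ) : ℂ)) 0 hy'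
      (Measurable.aestronglyMeasurable (by fun_prop)) ?_ ?_
    · have h2 := this.differentiableAt.neg
      refine DifferentiableAt.differentiableWithinAt ?_
      refine h2.congr_of_eventuallyEq (Eventually.of_forall fun y => ?_)
      simp only [Pi.neg_apply]
      rw [← integral_neg]
      congr 1; ext r; ring
    · simp only [zero_sub, mul_neg]
      exact (integrableOn_rpow_mul_cexp_neg_mul (by linarith) hy').neg
    · intro b hb
      refine (integrableOn_rpow_mul_exp_neg_mul (s := a) (by linarith) hb).congr_fun
        (fun r hr => ?_) measurableSet_Ioi
      have hr' : 0 < r := hr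
      simp only
      rw [Complex.norm_real, Real.norm_of_nonneg (Real.rpow_nonneg hr'.le _),
        mul_comm r (r ^ (a - 1)), ← Real.rpow_add_one hr'.ne', sub_add_cancel]
  have hg : AnalyticOnNhd ℂ (fun x : ℂ => (Real.Gamma a : ℂ) * x ^ (-a : ℂ)) U := by
    refine DifferentiableOn.analyticOnNhd (fun y hy => ?_) hUo
    have hy' : y ∈ Complex.slitPlane := Or.inl hy
    exact ((differentiableAt_id.cpow_const hy').const_mul _).differentiableWithinAt
  have hreal : ∀ y : ℝ, 0 < y → ∫ r in Ioi (0 : ℝ), ((r ^ (a - 1) : ℝ) : ℂ) *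
      Complex.exp (-((r : ℂ) * y)) = (Real.Gamma a : ℂ) * (y : ℂ) ^ (-a : ℂ) := by
    intro y hy
    have h := Real.integral_rpow_mul_exp_neg_mul_Ioi ha hy
    rw [one_div, Real.inv_rpow hy.le, ← Real.rpow_neg hy.le] at h
    have h2 := congrArg (fun t : ℝ => (t : ℂ)) h
    rw [← integral_complex_ofReal, Complex.ofReal_mul, Complex.ofReal_cpow hy.le] at h2
    rw [mul_comm, ← Complex.ofReal_neg, ← h2]
    congr 1; ext r
    push_cast
    rw [mul_comm (y : ℂ)]
  refine hf.eqOn_of_preconnected_of_frequently_eq hg (convex_halfSpace_re_gt 0).isPreconnected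
    (z₀ := 1) (by simp [hU]) ?_ hx
  have ht : Tendsto (fun n : ℕ => ((1 + 1 / ((n : ℝ) + 1) : ℝ) : ℂ)) atTop (𝓝[≠] 1) := by
    refine tendsto_nhdsWithin_iff.2 ⟨?_, Eventually.of_forall fun n => ?_⟩
    · have h1 : Tendsto (fun n : ℕ => (1 + 1 / ((n : ℝ) + 1) : ℝ)) atTop (𝓝 (1 + 0)) :=
        tendsto_one_div_add_atTop_nhds_zero_nat.const_add 1
      rw [add_zero] at h1
      have h2 := (Complex.continuous_ofReal.tendsto 1).comp h1
      rwa [Complex.ofReal_one] at h2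
    · have : (0 : ℝ) < 1 / ((n : ℝ) + 1) := by positivity
      intro h
      have h' : (1 + 1 / ((n : ℝ) + 1) : ℝ) = 1 :=
        Complex.ofReal_injective (by rw [Complex.ofReal_one]; exact h)
      linarith
  refine ht.frequently (Frequently.of_forall fun n => ?_)
  exact hreal _ (by positivity)

lemma aestronglyMeasurable_of_continuous {f : ℝ → ℂ} (hf : Continuous f) :
    AEStronglyMeasurable f (volume.restrict (Ioi 0)) := hf.aestronglyMeasurable

lemma integrableOn_rpow_mul_of_le {β C : ℝ} (h0 : 0 < β) (h2 : β < 2) {f : ℝ → ℂ}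
    (hf : AEStronglyMeasurable f (volume.restrict (Ioi 0)))
    (hC : ∀ r : ℝ, 0 < r → ‖f r‖ ≤ C * (min 1 r) ^ 2) :
    IntegrableOn (fun r : ℝ => ((r ^ (-β - 1) : ℝ) : ℂ) * f r) (Ioi 0) := by
  have hI := (integrableOn_min_sq_mul_rpow (n := 1) h0 (by simpa using h2)).const_mul C
  refine Integrable.mono' hI ((Measurable.aestronglyMeasurable (by fun_prop)).mul hf) ?_
  refine (ae_restrict_iff' measurableSet_Ioi).2 (Eventually.of_forall fun r hr => ?_)
  have hr' : 0 < r := hr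
  rw [norm_mul, Complex.norm_real, Real.norm_of_nonneg (Real.rpow_nonneg hr'.le _), pow_one]
  have := mul_le_mul_of_nonneg_left (hC r hr') (Real.rpow_nonneg hr'.le (-β - 1))
  linarith

lemma kConst_pos {α : ℝ} (hα : α ∈ Ioo (2 : ℝ) 4) : 0 < kConst α := by
  rw [kConst]
  have h1 := Real.Gamma_pos_of_pos (s := 2 - α / 2) (by linarith [hα.2])
  have h2 : 0 < α / 2 := by linarith [hα.1]
  have h3 : 0 < α / 2 - 1 := by linarith [hα.1]
  positivity

lemma cpow_mul_sq_eq {β : ℝ} {x : ℂ} (hx : x ≠ 0) :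
    x ^ 2 * x ^ (-((2 - β : ℝ)) : ℂ) = x ^ (β : ℂ) := by
  rw [← Complex.cpow_natCast, ← Complex.cpow_add _ _ hx]
  congr 1; push_cast; ring

/-- The bracket of powers as an integral of products. -/
lemma integral_one_sub_exp_mul_one_sub_exp {α : ℝ} (hα : α ∈ Ioo (2 : ℝ) 4) {x y : ℂ}
    (hx : 0 < x.re) (hy : 0 < y.re) :
    ∫ r in Ioi (0 : ℝ), ((r ^ (-(α / 2) - 1) : ℝ) : ℂ) *
      ((1 - Complex.exp (-((r : ℂ) * x))) * (1 - Complex.exp (-((r : ℂ) * y)))) =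
    kConst α * ((x + y) ^ ((α / 2 : ℝ) : ℂ) - (x ^ ((α / 2 : ℝ) : ℂ) + y ^ ((α / 2 : ℝ) : ℂ))) := by
  set β := α / 2 with hβ
  have hβ1 : 1 < β := by linarith [hα.1]
  have hβ2 : β < 2 := by linarith [hα.2]
  have hxy : 0 < (x + y).re := by rw [Complex.add_re]; linarith
  -- Two integrations by parts move the weight `r^(-β-1)` to `r^(1-β)` and `G` to `G''`, a
  -- combination of pure exponentials to which Euler's integral applies.
  set G : ℝ → ℂ := fun r =>
    (1 - Complex.exp (-((r : ℂ) * x))) * (1 - Complex.exp (-((r : ℂ) * y))) with hG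
  set G' : ℝ → ℂ := fun r =>
    x * (Complex.exp (-((r : ℂ) * x)) * (1 - Complex.exp (-((r : ℂ) * y)))) +
    y * (Complex.exp (-((r : ℂ) * y)) * (1 - Complex.exp (-((r : ℂ) * x)))) with hG'
  set G'' : ℝ → ℂ := fun r => (x + y) ^ 2 * Complex.exp (-((r : ℂ) * (x + y))) -
    (x ^ 2 * Complex.exp (-((r : ℂ) * x)) + y ^ 2 * Complex.exp (-((r : ℂ) * y))) with hG''
  have hexp : ∀ (w : ℂ) (r : ℝ), HasDerivAt (fun r : ℝ => Complex.exp (-((r : ℂ) * w)))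
      (-w * Complex.exp (-((r : ℂ) * w))) r := by
    intro w r
    have h1 : HasDerivAt (fun r : ℝ => -((r : ℂ) * w)) (-((1 : ℂ) * w)) r :=
      (Complex.ofRealCLM.hasDerivAt.mul_const w).neg
    refine h1.cexp.congr_deriv ?_
    ring
  have hdG : ∀ r, HasDerivAt G (G' r) r := by
    intro r
    refine (((hexp x r).const_sub 1).mul ((hexp y r).const_sub 1)).congr_deriv ?_
    simp only [hG']; ring
  have hdG' : ∀ r, HasDerivAt G' (G'' r) r := by
    intro r
    have h1 := ((hexp x r).mul ((hexp y r).const_sub 1)).const_mul x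
    have h2 := ((hexp y r).mul ((hexp x r).const_sub 1)).const_mul y
    refine (h1.add h2).congr_deriv ?_
    simp only [hG'']
    rw [show -((r : ℂ) * (x + y)) = -((r : ℂ) * x) + -((r : ℂ) * y) by ring, Complex.exp_add]
    ring
  set C : ℝ := 2 * (1 + ‖x‖) * (2 * (1 + ‖y‖)) with hC
  set C' : ℝ := ‖x‖ * (2 * (1 + ‖y‖)) + ‖y‖ * (2 * (1 + ‖x‖)) with hC'
  have hGb : ∀ r : ℝ, 0 ≤ r → ‖G r‖ ≤ C * (min 1 r) ^ 2 := by
    intro r hr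
    have h1 := norm_one_sub_exp_neg_mul_le hr hx.le
    have h2 := norm_one_sub_exp_neg_mul_le hr hy.le
    simp only [hG, norm_mul]
    calc _ ≤ (2 * (1 + ‖x‖) * min 1 r) * (2 * (1 + ‖y‖) * min 1 r) := by gcongr
      _ = _ := by rw [hC]; ring
  have hG'b : ∀ r : ℝ, 0 ≤ r → ‖G' r‖ ≤ C' * min 1 r := by
    intro r hr
    have h1 := norm_one_sub_exp_neg_mul_le hr hx.le
    have h2 := norm_one_sub_exp_neg_mul_le hr hy.le
    have h3 : ‖Complex.exp (-((r : ℂ) * x))‖ ≤ 1 :=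
      norm_exp_neg_le_one (by simpa using mul_nonneg hr hx.le)
    have h4 : ‖Complex.exp (-((r : ℂ) * y))‖ ≤ 1 :=
      norm_exp_neg_le_one (by simpa using mul_nonneg hr hy.le)
    simp only [hG']
    refine (norm_add_le _ _).trans ?_
    simp only [norm_mul]
    calc _ ≤ ‖x‖ * (1 * (2 * (1 + ‖y‖) * min 1 r)) + ‖y‖ * (1 * (2 * (1 + ‖x‖) * min 1 r)) := by
          gcongr
      _ = _ := by rw [hC']; ring
  have hGc : Continuous G := by rw [hG]; fun_prop
  have hIG : IntegrableOn (fun r : ℝ => ((r ^ (-β - 1) : ℝ) : ℂ) * G r) (Ioi 0) :=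
    integrableOn_rpow_mul_of_le (by linarith) hβ2 hGc.aestronglyMeasurable
      (fun r hr => hGb r hr.le)
  have e1 : ∀ w : ℂ, 0 < w.re → IntegrableOn (fun r : ℝ => ((r ^ ((2 - β) - 1) : ℝ) : ℂ) *
      (w ^ 2 * Complex.exp (-((r : ℂ) * w)))) (Ioi 0) := by
    intro w hw
    refine IntegrableOn.congr_fun ((integrableOn_rpow_mul_cexp_neg_mul (s := 2 - β - 1)
      (by linarith) hw).const_mul (w ^ 2)) (fun r _ => ?_) measurableSet_Ioi
    ring
  have e2 : ∀ w : ℂ, 0 < w.re → ∫ r in Ioi (0 : ℝ), ((r ^ ((2 - β) - 1) : ℝ) : ℂ) *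
      (w ^ 2 * Complex.exp (-((r : ℂ) * w))) = Real.Gamma (2 - β) * w ^ (β : ℂ) := by
    intro w hw
    have hw0 : w ≠ 0 := by rintro rfl; simp at hw
    rw [← cpow_mul_sq_eq hw0]
    have := integral_rpow_mul_cexp_neg_mul (a := 2 - β) (by linarith) hw
    rw [mul_left_comm, ← this, ← integral_const_mul]
    congr 1; ext r; ring
  have hG''e : (fun r : ℝ => ((r ^ ((2 - β) - 1) : ℝ) : ℂ) * G'' r) = fun r : ℝ =>
      ((r ^ ((2 - β) - 1) : ℝ) : ℂ) * ((x + y) ^ 2 * Complex.exp (-((r : ℂ) * (x + y)))) -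
      (((r ^ ((2 - β) - 1) : ℝ) : ℂ) * (x ^ 2 * Complex.exp (-((r : ℂ) * x))) +
      ((r ^ ((2 - β) - 1) : ℝ) : ℂ) * (y ^ 2 * Complex.exp (-((r : ℂ) * y)))) := by
    funext r; simp only [hG'']; ring
  have hIG'' : IntegrableOn (fun r : ℝ => ((r ^ ((2 - β) - 1) : ℝ) : ℂ) * G'' r) (Ioi 0) := by
    rw [hG''e]
    exact (e1 _ hxy).sub ((e1 _ hx).add (e1 _ hy))
  have hJ : ∫ r in Ioi (0 : ℝ), ((r ^ ((2 - β) - 1) : ℝ) : ℂ) * G'' r =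
      Real.Gamma (2 - β) * ((x + y) ^ (β : ℂ) - (x ^ (β : ℂ) + y ^ (β : ℂ))) := by
    rw [hG''e, integral_sub (e1 _ hxy) (show Integrable (fun r : ℝ =>
      ((r ^ ((2 - β) - 1) : ℝ) : ℂ) * (x ^ 2 * Complex.exp (-((r : ℂ) * x))) +
      ((r ^ ((2 - β) - 1) : ℝ) : ℂ) * (y ^ 2 * Complex.exp (-((r : ℂ) * y))))
      (volume.restrict (Ioi 0)) from
      (e1 _ hx).add (e1 _ hy)), integral_add (e1 _ hx) (e1 _ hy), e2 _ hxy, e2 _ hx, e2 _ hy]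
    ring
  have hβ0 : (β : ℂ) ≠ 0 := by exact_mod_cast (by linarith : β ≠ 0)
  have hβ10 : (β : ℂ) - 1 ≠ 0 := by
    rw [← Complex.ofReal_one, ← Complex.ofReal_sub]
    exact_mod_cast (by linarith : β - 1 ≠ 0)
  -- The collected boundary terms. They vanish at `0` since `G = O(r²)`, `G' = O(r)` and `β < 2`,
  -- and at infinity since `G`, `G'` are bounded and `β > 1`.
  set A : ℝ → ℂ := fun r => -((r ^ (-β) : ℝ) : ℂ) * G r / β -
    ((r ^ (1 - β) : ℝ) : ℂ) * G' r / (β * (β - 1)) with hA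
  have hAd : ∀ r ∈ Ioi (0 : ℝ), HasDerivAt A (((r ^ (-β - 1) : ℝ) : ℂ) * G r -
      (((r ^ ((2 - β) - 1) : ℝ) : ℂ) * G'' r) / (β * (β - 1))) r := by
    intro r hr
    have hr0 : r ≠ 0 := ne_of_gt hr
    have h1 := (Real.hasDerivAt_rpow_const (x := r) (p := -β) (Or.inl hr0)).ofReal_comp
    have h2 := (Real.hasDerivAt_rpow_const (x := r) (p := 1 - β) (Or.inl hr0)).ofReal_comp
    refine (((h1.neg.mul (hdG r)).div_const _).sub ((h2.mul (hdG' r)).div_const _)).congr_deriv ?_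
    rw [show 1 - β - 1 = -β by ring, show 2 - β - 1 = 1 - β by ring]
    push_cast
    simp only [Pi.neg_apply]
    field_simp
    ring
  have hAb : ∀ r : ℝ, 0 < r → ‖A r‖ ≤
      r ^ (-β) * (C * (min 1 r) ^ 2) / β + r ^ (1 - β) * (C' * min 1 r) / (β * (β - 1)) := by
    intro r hr
    have p1 := Real.rpow_nonneg hr.le (-β)
    have p2 := Real.rpow_nonneg hr.le (1 - β)
    have n2 : ‖(β : ℂ) - 1‖ = β - 1 := by
      rw [← Complex.ofReal_one, ← Complex.ofReal_sub, Complex.norm_real,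
        Real.norm_of_nonneg (by linarith)]
    refine (norm_sub_le _ _).trans ?_
    rw [norm_div, norm_div, norm_mul _ (G r), norm_mul _ (G' r), norm_mul (β : ℂ), norm_neg, n2,
      Complex.norm_real, Complex.norm_real, Complex.norm_real, Real.norm_of_nonneg p1,
      Real.norm_of_nonneg p2, Real.norm_of_nonneg (by linarith : 0 ≤ β)]
    have := hGb r hr.le
    have := hG'b r hr.le
    have : 0 < β - 1 := by linarith
    gcongr
  have hC0 : 0 ≤ C := by positivity
  have hC'0 : 0 ≤ C' := by positivity
  have hA0 : A 0 = 0 := by simp [hA, hG, hG']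
  have hAc : ContinuousWithinAt A (Ici 0) 0 := by
    rw [← continuousWithinAt_Ioi_iff_Ici, ContinuousWithinAt, hA0]
    have hlim : Tendsto (fun r : ℝ => r ^ (2 - β) * (C / β + C' / (β * (β - 1)))) (𝓝[>] 0)
        (𝓝 0) := by
      have h1 : ContinuousAt (fun r : ℝ => r ^ (2 - β)) 0 :=
        Real.continuousAt_rpow_const _ _ (Or.inr (by linarith))
      have h2 := (h1.tendsto.mono_left (nhdsWithin_le_nhds (s := Ioi 0))).mul_const
        (C / β + C' / (β * (β - 1)))
      rwa [Real.zero_rpow (by linarith), zero_mul] at h2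
    refine squeeze_zero_norm' ?_ hlim
    filter_upwards [self_mem_nhdsWithin] with r hr
    have hr' : 0 < r := hr
    refine (hAb r hr').trans ?_
    have k1 : r ^ (2 - β) = r ^ (-β) * r ^ 2 := by
      rw [← Real.rpow_natCast r 2, ← Real.rpow_add hr']; congr 1; push_cast; ring
    have k2 : r ^ (2 - β) = r ^ (1 - β) * r := by
      rw [← Real.rpow_add_one hr'.ne']; congr 1; ring
    have p1 := Real.rpow_nonneg hr'.le (-β)
    have p2 := Real.rpow_nonneg hr'.le (1 - β)
    have m0 : 0 ≤ min 1 r := le_min zero_le_one hr'.le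
    have m1 : min 1 r ≤ r := min_le_right _ _
    have : 0 < β - 1 := by linarith
    calc _ ≤ r ^ (-β) * (C * r ^ 2) / β + r ^ (1 - β) * (C' * r) / (β * (β - 1)) := by gcongr
      _ = (r ^ (-β) * r ^ 2) * (C / β) + (r ^ (1 - β) * r) * (C' / (β * (β - 1))) := by ring
      _ = _ := by rw [← k1, ← k2]; ring
  have hAt : Tendsto A atTop (𝓝 0) := by
    have hlim : Tendsto (fun r : ℝ => r ^ (-β) * (C / β) + r ^ (-(β - 1)) * (C' / (β * (β - 1))))
        atTop (𝓝 0) := by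
      have h1 := (tendsto_rpow_neg_atTop (show 0 < β by linarith)).mul_const (C / β)
      have h2 := (tendsto_rpow_neg_atTop (show 0 < β - 1 by linarith)).mul_const
        (C' / (β * (β - 1)))
      simpa using h1.add h2
    refine squeeze_zero_norm' ?_ hlim
    filter_upwards [eventually_gt_atTop 0] with r hr'
    refine (hAb r hr').trans ?_
    have p1 := Real.rpow_nonneg hr'.le (-β)
    have p2 := Real.rpow_nonneg hr'.le (1 - β)
    have m0 : 0 ≤ min 1 r := le_min zero_le_one hr'.le
    have m1 : min 1 r ≤ 1 := min_le_left _ _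
    have : 0 < β - 1 := by linarith
    calc _ ≤ r ^ (-β) * (C * 1 ^ 2) / β + r ^ (1 - β) * (C' * 1) / (β * (β - 1)) := by gcongr
      _ = _ := by rw [show -(β - 1) = 1 - β by ring]; ring
  have hfin := integral_Ioi_of_hasDerivAt_of_tendsto hAc hAd (hIG.sub (hIG''.div_const _)) hAt
  rw [integral_sub hIG (hIG''.div_const _), integral_div, hJ, hA0, sub_zero, sub_eq_zero] at hfin
  rw [hfin, kConst, ← hβ]
  push_cast
  ring

/-! ### A Fubini theorem for integrals of products -/

section
variable {X A B : Type*} [MeasurableSpace X] [MeasurableSpace A] [MeasurableSpace B]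
  {μ : Measure X} {ν₁ : Measure A} {ν₂ : Measure B} [SFinite μ] [SFinite ν₁] [SFinite ν₂]

/-- For fixed `x` the absolute integral over `A × B` factorizes, so separate `L¹` bounds on the two
factors suffice for Fubini. It serves twice: with `x = r` and `(a, b) = (t, s)`, then with `x = u`
and `(a, b) = (E, F)`. -/
lemma integrable_integral_mul_and_integral_eq {w : X → ℂ} {g₁ : X → A → ℂ} {g₂ : X → B → ℂ}
    {b₁ b₂ : X → ℝ} (hw : Measurable w) (hg₁ : Measurable (Function.uncurry g₁))
    (hg₂ : Measurable (Function.uncurry g₂))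
    (h₁ : ∀ᵐ x ∂μ, Integrable (g₁ x) ν₁ ∧ ∫ a, ‖g₁ x a‖ ∂ν₁ ≤ b₁ x)
    (h₂ : ∀ᵐ x ∂μ, Integrable (g₂ x) ν₂ ∧ ∫ b, ‖g₂ x b‖ ∂ν₂ ≤ b₂ x)
    (hi : Integrable (fun x => ‖w x‖ * (b₁ x * b₂ x)) μ) :
    Integrable (fun p : A × B => ∫ x, w x * (g₁ x p.1 * g₂ x p.2) ∂μ) (ν₁.prod ν₂) ∧
    ∫ p : A × B, (∫ x, w x * (g₁ x p.1 * g₂ x p.2) ∂μ) ∂(ν₁.prod ν₂) =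
      ∫ x, w x * ((∫ a, g₁ x a ∂ν₁) * ∫ b, g₂ x b ∂ν₂) ∂μ := by
  set F : X × (A × B) → ℂ := fun q => w q.1 * (g₁ q.1 q.2.1 * g₂ q.1 q.2.2) with hF
  have hFm : Measurable F := by
    refine (hw.comp measurable_fst).mul (Measurable.mul ?_ ?_)
    · exact hg₁.comp (measurable_fst.prodMk (measurable_fst.comp measurable_snd))
    · exact hg₂.comp (measurable_fst.prodMk (measurable_snd.comp measurable_snd))
  have hFi : Integrable F (μ.prod (ν₁.prod ν₂)) := by
    rw [integrable_prod_iff hFm.aestronglyMeasurable]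
    constructor
    · filter_upwards [h₁, h₂] with x hx₁ hx₂
      exact (hx₁.1.mul_prod hx₂.1).const_mul (w x)
    · refine Integrable.mono' hi
        hFm.aestronglyMeasurable.norm.integral_prod_right' ?_
      filter_upwards [h₁, h₂] with x hx₁ hx₂
      have e : ∫ y : A × B, ‖F (x, y)‖ ∂(ν₁.prod ν₂) =
          ‖w x‖ * ((∫ a, ‖g₁ x a‖ ∂ν₁) * ∫ b, ‖g₂ x b‖ ∂ν₂) := by
        rw [← integral_prod_mul, ← integral_const_mul]
        simp only [hF, norm_mul]
      rw [e]
      have p1 : 0 ≤ ∫ a, ‖g₁ x a‖ ∂ν₁ := integral_nonneg fun _ => norm_nonneg _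
      have p2 : 0 ≤ ∫ b, ‖g₂ x b‖ ∂ν₂ := integral_nonneg fun _ => norm_nonneg _
      rw [Real.norm_of_nonneg (by positivity)]
      have := p1.trans hx₁.2
      gcongr
      · exact hx₁.2
      · exact hx₂.2
  refine ⟨hFi.integral_prod_right, ?_⟩
  have hs := integral_integral_swap (f := fun (x : X) (p : A × B) =>
    w x * (g₁ x p.1 * g₂ x p.2)) hFi
  rw [← hs]
  congr 1
  ext x
  rw [integral_const_mul, integral_prod_mul]

end

/-! ### The covariance as a single integral -/

/-- `(1 - e^{-r t κ}) e^{-t / κ}`. -/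
def expFactor (κ : ℂ) (r t : ℝ) : ℂ :=
  (1 - Complex.exp (-((r : ℂ) * (t * κ)))) * Complex.exp (-((t : ℂ) * κ⁻¹))

/-- The `κ`-derivative of `expFactor κ r t`, divided by `t`. -/
def expFactorDeriv (κ : ℂ) (r t : ℝ) : ℂ :=
  (r * Complex.exp (-((r : ℂ) * (t * κ))) +
    (1 - Complex.exp (-((r : ℂ) * (t * κ)))) * (κ ^ 2)⁻¹) * Complex.exp (-((t : ℂ) * κ⁻¹))

lemma inv_re_pos {κ : ℂ} (hκ : 0 < κ.re) : 0 < κ⁻¹.re := by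
  rw [Complex.inv_re]
  have : κ ≠ 0 := by rintro rfl; simp at hκ
  have := Complex.normSq_pos.2 this
  positivity

lemma mul_exp_neg_mul_le {r b : ℝ} (hr : 0 ≤ r) (hb : 0 < b) :
    r * rexp (-(r * b)) ≤ (1 + b⁻¹) * min 1 r := by
  have he : rexp (-(r * b)) ≤ 1 := Real.exp_le_one_iff.2 (by nlinarith)
  have hb' : 0 < b⁻¹ := inv_pos.2 hb
  rcases le_total 1 r with h | h
  · rw [min_eq_left h]
    have h1 : r * b ≤ rexp (r * b) := by linarith [Real.add_one_le_exp (r * b)]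
    have h2 : r * b * rexp (-(r * b)) ≤ 1 := by
      rw [Real.exp_neg]
      rw [← div_eq_mul_inv, div_le_one (Real.exp_pos _)]; exact h1
    have h3 : r * rexp (-(r * b)) ≤ b⁻¹ := by
      rw [← mul_le_mul_iff_left₀ hb, inv_mul_cancel₀ hb.ne']
      linarith
    linarith
  · rw [min_eq_right h]
    nlinarith [Real.exp_pos (-(r * b))]

lemma ofReal_mul_re_pos {t : ℝ} (ht : 0 < t) {κ : ℂ} (hκ : 0 < κ.re) : 0 < ((t : ℂ) * κ).re := by
  simpa using mul_pos ht hκ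

lemma norm_expFactor_le {κ : ℂ} (hκ : 0 < κ.re) {r t : ℝ} (hr : 0 ≤ r) (ht : 0 < t) :
    ‖expFactor κ r t‖ ≤ 2 * (1 + ‖(t : ℂ) * κ‖) * min 1 r := by
  rw [expFactor, norm_mul]
  have h1 := norm_one_sub_exp_neg_mul_le hr (ofReal_mul_re_pos ht hκ).le
  have h2 := norm_exp_neg_le_one (ofReal_mul_re_pos ht (inv_re_pos hκ)).le
  have := norm_nonneg (1 - Complex.exp (-((r : ℂ) * (t * κ))))
  have := norm_nonneg (Complex.exp (-((t : ℂ) * κ⁻¹)))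
  nlinarith

/-- The first term keeps its decay in `rt`: its integral over `t` is then bounded in `r`, whereas
the prefactor `r` alone is not. -/
lemma norm_expFactorDeriv_le {κ : ℂ} (hκ : 0 < κ.re) {r t : ℝ} (hr : 0 ≤ r) (ht : 0 < t) :
    ‖expFactorDeriv κ r t‖ ≤ r * rexp (-((r * κ.re + κ⁻¹.re) * t)) +
      min 1 r * (2 * (1 + t * ‖κ‖) * ‖(κ ^ 2)⁻¹‖ * rexp (-(t * κ⁻¹.re))) := by
  have h1 := norm_one_sub_exp_neg_mul_le hr (ofReal_mul_re_pos ht hκ).le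
  rw [norm_mul, Complex.norm_real, Real.norm_of_nonneg ht.le] at h1
  rw [expFactorDeriv, norm_mul, norm_exp_neg_mul]
  have h3 : rexp (-((r * κ.re + κ⁻¹.re) * t)) = rexp (-(r * (t * κ.re))) *
      rexp (-(t * κ⁻¹.re)) := by
    rw [← Real.exp_add]; congr 1; ring
  rw [h3]
  have h4 : ‖(r : ℂ) * Complex.exp (-((r : ℂ) * (t * κ))) +
    (1 - Complex.exp (-((r : ℂ) * (t * κ)))) * (κ ^ 2)⁻¹‖ ≤ r * rexp (-(r * (t * κ.re))) +
      2 * (1 + t * ‖κ‖) * min 1 r * ‖(κ ^ 2)⁻¹‖ := by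
    refine (norm_add_le _ _).trans ?_
    rw [norm_mul, norm_mul, norm_exp_neg_mul, Complex.norm_real, Real.norm_of_nonneg hr,
      Complex.re_ofReal_mul]
    gcongr
  calc _ ≤ (r * rexp (-(r * (t * κ.re))) +
      2 * (1 + t * ‖κ‖) * min 1 r * ‖(κ ^ 2)⁻¹‖) * rexp (-(t * κ⁻¹.re)) := by gcongr
    _ = _ := by ring

lemma exists_norm_expFactorDeriv_le {κ : ℂ} (hκ : 0 < κ.re) {t : ℝ} (ht : 0 < t) :
    ∃ C : ℝ, ∀ r : ℝ, 0 < r → ‖expFactorDeriv κ r t‖ ≤ C * min 1 r := by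
  refine ⟨(1 + (κ.re * t)⁻¹) + 2 * (1 + t * ‖κ‖) * ‖(κ ^ 2)⁻¹‖ * rexp (-(t * κ⁻¹.re)),
    fun r hr => (norm_expFactorDeriv_le hκ hr.le ht).trans ?_⟩
  have h1 := mul_exp_neg_mul_le hr.le (mul_pos hκ ht)
  have h2 : rexp (-((r * κ.re + κ⁻¹.re) * t)) ≤ rexp (-(r * (κ.re * t))) := by
    apply Real.exp_le_exp.2
    have := mul_pos (inv_re_pos hκ) ht
    linarith
  have h3 := mul_le_mul_of_nonneg_left h2 hr.le
  linarith

lemma continuous_expFactor (κ : ℂ) : Continuous (Function.uncurry (expFactor κ)) := by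
  unfold Function.uncurry expFactor; fun_prop

lemma continuous_expFactorDeriv (κ : ℂ) : Continuous (Function.uncurry (expFactorDeriv κ)) := by
  unfold Function.uncurry expFactorDeriv; fun_prop

lemma expFactorDeriv_eq (κ : ℂ) (r t : ℝ) : expFactorDeriv κ r t =
    (r - (κ ^ 2)⁻¹) * Complex.exp (-(r * κ + κ⁻¹) * t) +
      (κ ^ 2)⁻¹ * Complex.exp (-κ⁻¹ * t) := by
  have h1 : Complex.exp (-(r * κ + κ⁻¹) * t) = Complex.exp (-((r : ℂ) * (t * κ))) *
      Complex.exp (-((t : ℂ) * κ⁻¹)) := by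
    rw [← Complex.exp_add]; congr 1; ring
  have h2 : Complex.exp (-κ⁻¹ * t) = Complex.exp (-((t : ℂ) * κ⁻¹)) := by
    congr 1; ring
  rw [expFactorDeriv, h1, h2]; ring

lemma mul_add_inv_re_pos {κ : ℂ} (hκ : 0 < κ.re) {r : ℝ} (hr : 0 < r) :
    0 < ((r : ℂ) * κ + κ⁻¹).re := by
  rw [Complex.add_re]
  exact add_pos (ofReal_mul_re_pos hr hκ) (inv_re_pos hκ)

lemma integrableOn_expFactorDeriv {κ : ℂ} (hκ : 0 < κ.re) {r : ℝ} (hr : 0 < r) :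
    IntegrableOn (expFactorDeriv κ r) (Ioi 0) := by
  rw [funext (expFactorDeriv_eq κ r)]
  have h1 := integrableOn_exp_mul_complex_Ioi (a := -(r * κ + κ⁻¹))
    (by rw [Complex.neg_re]; linarith [mul_add_inv_re_pos hκ hr]) 0
  have h2 := integrableOn_exp_mul_complex_Ioi (a := -κ⁻¹)
    (by rw [Complex.neg_re]; linarith [inv_re_pos hκ]) 0
  exact (h1.const_mul _).add (h2.const_mul _)

/-- The two exponentials give `(r - κ⁻²)/(rκ + κ⁻¹) + κ⁻¹`, and the terms in `κ⁻²` cancel over the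
common denominator. -/
lemma integral_expFactorDeriv {κ : ℂ} (hκ : 0 < κ.re) {r : ℝ} (hr : 0 < r) :
    ∫ t in Ioi (0 : ℝ), expFactorDeriv κ r t = 2 * r / (r * κ + κ⁻¹) := by
  simp_rw [expFactorDeriv_eq κ r]
  have n1 : (-(r * κ + κ⁻¹)).re < 0 := by
    rw [Complex.neg_re]; linarith [mul_add_inv_re_pos hκ hr]
  have n2 : (-κ⁻¹).re < 0 := by rw [Complex.neg_re]; linarith [inv_re_pos hκ]
  have h1 := integrableOn_exp_mul_complex_Ioi n1 0
  have h2 := integrableOn_exp_mul_complex_Ioi n2 0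
  rw [integral_add (h1.const_mul _) (h2.const_mul _), integral_const_mul, integral_const_mul,
    integral_exp_mul_complex_Ioi n1, integral_exp_mul_complex_Ioi n2]
  have hκ0 : κ ≠ 0 := by rintro rfl; simp at hκ
  have hD : (r : ℂ) * κ + κ⁻¹ ≠ 0 := by
    intro h; have := mul_add_inv_re_pos hκ hr; rw [h] at this; simp at this
  simp only [Complex.ofReal_zero, mul_zero, Complex.exp_zero, neg_div_neg_eq]
  have hD2 : (r : ℂ) * κ ^ 2 + 1 ≠ 0 := by
    intro h; apply hD; field_simp; rw [h, mul_zero]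
  have hD3 : (r : ℂ) * κ + κ⁻¹ = (r * κ ^ 2 + 1) / κ := by field_simp
  rw [hD3]
  field_simp
  ring

/-- One power of `min(1, r)` per factor: two of them are integrable against `r^(-α/2-1)`, which
gives the absolute convergence of `C(z, w)`. -/
lemma exists_integral_norm_expFactorDeriv_le {κ : ℂ} (hκ : 0 < κ.re) :
    ∃ C : ℝ, ∀ r : ℝ, 0 < r → ∫ t in Ioi (0 : ℝ), ‖expFactorDeriv κ r t‖ ≤ C * min 1 r := by
  have hb := inv_re_pos hκ
  set f : ℝ → ℝ := fun t => 2 * (1 + t * ‖κ‖) * ‖(κ ^ 2)⁻¹‖ * rexp (-(t * κ⁻¹.re)) with hf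
  have hfi : IntegrableOn f (Ioi 0) := by
    have i0 := integrableOn_rpow_mul_exp_neg_mul (s := 0) (by norm_num) hb
    have i1 := integrableOn_rpow_mul_exp_neg_mul (s := 1) (by norm_num) hb
    refine IntegrableOn.congr_fun ((i0.const_mul (2 * ‖(κ ^ 2)⁻¹‖)).add
      (i1.const_mul (2 * ‖κ‖ * ‖(κ ^ 2)⁻¹‖))) (fun t _ => ?_) measurableSet_Ioi
    simp only [hf, Real.rpow_zero, Real.rpow_one, Pi.add_apply]
    ring
  refine ⟨(κ.re⁻¹ + κ⁻¹.re⁻¹) + ∫ t in Ioi (0 : ℝ), f t, fun r hr => ?_⟩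
  have hp : 0 < r * κ.re + κ⁻¹.re := by positivity
  have he : IntegrableOn (fun t => rexp (-((r * κ.re + κ⁻¹.re) * t))) (Ioi 0) := by
    have := integrableOn_rpow_mul_exp_neg_mul (s := 0) (by norm_num) hp
    refine this.congr_fun (fun t _ => ?_) measurableSet_Ioi
    simp only [Real.rpow_zero, one_mul]
    rw [mul_comm]
  have hei : ∫ t in Ioi (0 : ℝ), rexp (-((r * κ.re + κ⁻¹.re) * t)) = (r * κ.re + κ⁻¹.re)⁻¹ := by
    have := integral_exp_mul_Ioi (a := -(r * κ.re + κ⁻¹.re)) (by linarith) 0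
    simp only [neg_mul] at this
    rw [this]
    simp only [mul_zero, neg_zero, Real.exp_zero]
    rw [neg_div_neg_eq, one_div]
  calc ∫ t in Ioi (0 : ℝ), ‖expFactorDeriv κ r t‖
      ≤ ∫ t in Ioi (0 : ℝ), (r * rexp (-((r * κ.re + κ⁻¹.re) * t)) + min 1 r * f t) :=
        setIntegral_mono_on (integrableOn_expFactorDeriv hκ hr).norm
          ((he.const_mul r).add (hfi.const_mul _)) measurableSet_Ioi
          (fun t ht => norm_expFactorDeriv_le hκ hr.le ht)
    _ = r * (r * κ.re + κ⁻¹.re)⁻¹ + min 1 r * ∫ t in Ioi (0 : ℝ), f t := by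
        rw [integral_add (he.const_mul r) (hfi.const_mul _), integral_const_mul,
          integral_const_mul, hei]
    _ ≤ _ := by
        have h1 : r * (r * κ.re + κ⁻¹.re)⁻¹ ≤ (κ.re⁻¹ + κ⁻¹.re⁻¹) * min 1 r := by
          have q1 : 0 < κ.re⁻¹ := inv_pos.2 hκ
          have q2 : 0 < κ⁻¹.re⁻¹ := inv_pos.2 hb
          have k1 : r * (r * κ.re + κ⁻¹.re)⁻¹ ≤ κ.re⁻¹ := by
            rw [← div_eq_mul_inv, div_le_iff₀ hp, mul_add, mul_comm r, ← mul_assoc,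
              inv_mul_cancel₀ hκ.ne']
            nlinarith [mul_pos q1 hb]
          have k2 : r * (r * κ.re + κ⁻¹.re)⁻¹ ≤ κ⁻¹.re⁻¹ * r := by
            rw [mul_comm]
            gcongr
            nlinarith [mul_pos hr hκ]
          rcases le_total 1 r with h | h
          · rw [min_eq_left h]; linarith
          · rw [min_eq_right h]; nlinarith
        linarith

/-- Differentiation under the integral sign against a weight `r ^ (-β - 1) g(r)`. -/
lemma hasDerivAt_integral_expFactor {β C : ℝ} (h0 : 0 < β) (h2 : β < 2) {g : ℝ → ℂ}
    (hg : Continuous g) (hC : ∀ r : ℝ, 0 < r → ‖g r‖ ≤ C * min 1 r) {κ : ℂ} (hκ : 0 < κ.re)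
    {t : ℝ} (ht : 0 < t) :
    HasDerivAt (fun y : ℂ => ∫ r in Ioi (0 : ℝ), ((r ^ (-β - 1) : ℝ) : ℂ) * (g r * expFactor y r t))
      (∫ r in Ioi (0 : ℝ), ((r ^ (-β - 1) : ℝ) : ℂ) * (g r * (t * expFactorDeriv κ r t))) κ := by
  have hx := ofReal_mul_re_pos ht hκ
  -- `g` carries the other variable and vanishes to first order at `r = 0`; with the first-order
  -- zero of `1 - e^(-rtκ)` or the factor `r`, this makes the singular weight integrable.
  set h : ℝ → ℂ := fun r => ((r ^ (-β - 1) : ℝ) : ℂ) * g r with hh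
  have hm : Measurable h := Measurable.mul (by fun_prop) hg.measurable
  have hi : IntegrableOn (fun r : ℝ => h r * (1 - Complex.exp (-((r : ℂ) * (t * κ))))) (Ioi 0) := by
    simp only [hh, mul_assoc]
    refine integrableOn_rpow_mul_of_le (C := C * (2 * (1 + ‖(t : ℂ) * κ‖))) h0 h2
      (aestronglyMeasurable_of_continuous (hg.mul (by fun_prop))) (fun r hr => ?_)
    rw [norm_mul]
    have := norm_one_sub_exp_neg_mul_le hr.le hx.le
    calc _ ≤ (C * min 1 r) * (2 * (1 + ‖(t : ℂ) * κ‖) * min 1 r) :=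
          mul_le_mul (hC r hr) this (norm_nonneg _) ((norm_nonneg _).trans (hC r hr))
      _ = _ := by ring
  have hb : ∀ b : ℝ, 0 < b →
      IntegrableOn (fun r : ℝ => r * ‖h r‖ * rexp (-(r * b))) (Ioi 0) := by
    intro b hb
    have := integrableOn_rpow_mul_of_le (β := β) (C := C * (1 + b⁻¹)) h0 h2
      (f := fun r : ℝ => g r * (r * Complex.exp (-((r : ℂ) * b))))
      (aestronglyMeasurable_of_continuous (hg.mul (by fun_prop))) (fun r hr => ?_)
    · refine IntegrableOn.congr_fun this.norm (fun r hr => ?_) measurableSet_Ioi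
      have hr' : 0 < r := hr
      simp only [hh, norm_mul, norm_exp_neg_mul, Complex.norm_real, Complex.ofReal_re,
        Real.norm_of_nonneg hr'.le]
      ring
    · rw [norm_mul, norm_mul, norm_exp_neg_mul, Complex.norm_real, Real.norm_of_nonneg hr.le,
        Complex.ofReal_re]
      have := mul_exp_neg_mul_le hr.le hb
      calc _ ≤ (C * min 1 r) * ((1 + b⁻¹) * min 1 r) :=
          mul_le_mul (hC r hr) this (by positivity) ((norm_nonneg _).trans (hC r hr))
        _ = _ := by ring
  have hi2 : IntegrableOn (fun r : ℝ => h r * (r * Complex.exp (-((r : ℂ) * (t * κ)))))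
      (Ioi 0) := by
    refine Integrable.mono' (hb _ hx) (hm.aestronglyMeasurable.mul
      (aestronglyMeasurable_of_continuous (by fun_prop))) ?_
    refine (ae_restrict_iff' measurableSet_Ioi).2 (Eventually.of_forall fun r hr => ?_)
    have hr' : 0 < r := hr
    rw [norm_mul (h r), norm_mul (r : ℂ), norm_exp_neg_mul, Complex.norm_real,
      Real.norm_of_nonneg hr'.le]
    apply le_of_eq; ring
  have hκ0 : κ ≠ 0 := by rintro rfl; simp at hκ
  have hQ := hasDerivAt_integral_mul_sub_exp 1 hx hm.aestronglyMeasurable hi hb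
  have hQ' : HasDerivAt (fun y : ℂ => ∫ r in Ioi (0 : ℝ),
      h r * (1 - Complex.exp (-((r : ℂ) * (t * y))))) _ κ :=
    HasDerivAt.comp κ hQ ((hasDerivAt_id κ).const_mul (t : ℂ))
  have hE : HasDerivAt (fun y : ℂ => Complex.exp (-((t : ℂ) * y⁻¹)))
      (Complex.exp (-((t : ℂ) * κ⁻¹)) * -((t : ℂ) * -(κ ^ 2)⁻¹)) κ :=
    (((hasDerivAt_inv hκ0).const_mul (t : ℂ)).neg).cexp
  have hfin := hQ'.mul hE
  refine (hfin.congr_of_eventuallyEq (Eventually.of_forall fun y => ?_)).congr_deriv ?_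
  · simp only [Pi.mul_apply]
    rw [← integral_mul_const]
    congr 1; ext r
    simp only [hh, expFactor]; ring
  · have e : ∀ r : ℝ, ((r ^ (-β - 1) : ℝ) : ℂ) * (g r * (t * expFactorDeriv κ r t)) =
        h r * (r * Complex.exp (-((r : ℂ) * (t * κ)))) * (t * Complex.exp (-((t : ℂ) * κ⁻¹))) +
        h r * (1 - Complex.exp (-((r : ℂ) * (t * κ)))) *
          (Complex.exp (-((t : ℂ) * κ⁻¹)) * (t * (κ ^ 2)⁻¹)) := by
      intro r; simp only [hh, expFactorDeriv]; ring
    simp_rw [e]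
    rw [integral_add (hi2.mul_const _) (hi.mul_const _), integral_mul_const, integral_mul_const]
    ring

/-- The separation of variables: for fixed `r` the integrand is a function of `(z, t)` times a
function of `(w, s)`. -/
lemma covBracket_eq {α : ℝ} (hα : α ∈ Ioo (2 : ℝ) 4) {z w : ℂ} (hz : z.im ≠ 0) (hw : w.im ≠ 0)
    {t s : ℝ} (ht : 0 < t) (hs : 0 < s) :
    covBracket α z w t s = (kConst α : ℂ)⁻¹ * ∫ r in Ioi (0 : ℝ), ((r ^ (-(α / 2) - 1) : ℝ) : ℂ) *
      (expFactor (rotatedStieltjes z) r t * expFactor (rotatedStieltjes w) r s) := by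
  have hk : (kConst α : ℂ) ≠ 0 := by exact_mod_cast (kConst_pos hα).ne'
  have hx := ofReal_mul_re_pos ht (rotatedStieltjes_re_pos hz)
  have hy := ofReal_mul_re_pos hs (rotatedStieltjes_re_pos hw)
  have h := integral_one_sub_exp_mul_one_sub_exp hα hx hy
  have hexp : (Real.sign z.im : ℂ) * Complex.I * (t : ℂ) * z - t * rotatedStieltjes z
      + (Real.sign w.im : ℂ) * Complex.I * (s : ℂ) * w - s * rotatedStieltjes w =
      -((t : ℂ) * (rotatedStieltjes z)⁻¹) + -((s : ℂ) * (rotatedStieltjes w)⁻¹) := by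
    linear_combination (t : ℂ) * sign_mul_I_mul_sub hz + s * sign_mul_I_mul_sub hw
  rw [covBracket, covExponent_eq, covExponent_eq, hexp, Complex.exp_add,
    eq_inv_mul_iff_mul_eq₀ hk, ← mul_assoc, ← h, ← integral_mul_const]
  congr 1; ext r
  simp only [expFactor]; ring

/-- The derivative of `rotatedStieltjes`. -/
def rotatedStieltjesDeriv (z : ℂ) : ℂ := (Real.sign z.im : ℂ) * Complex.I *
  (-(semicircleStieltjes z) ^ 2 / (1 - semicircleStieltjes z ^ 2))

lemma covIntegrand_eq {c α : ℝ} (hα : α ∈ Ioo (2 : ℝ) 4) {z w : ℂ} (hz : z.im ≠ 0)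
    (hw : w.im ≠ 0) {t s : ℝ} (ht : 0 < t) (hs : 0 < s) :
    covIntegrand c α z w (t, s) =
      ((c / kConst α : ℝ) : ℂ) * (rotatedStieltjesDeriv z * rotatedStieltjesDeriv w) *
      ∫ r in Ioi (0 : ℝ), ((r ^ (-(α / 2) - 1) : ℝ) : ℂ) *
        (expFactorDeriv (rotatedStieltjes z) r t * expFactorDeriv (rotatedStieltjes w) r s) := by
  have hβ1 : 0 < α / 2 := by linarith [hα.1]
  have hβ2 : α / 2 < 2 := by linarith [hα.2]
  -- Needed for every `z'` off the axis, as the outer derivative sees this expression on a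
  -- neighbourhood of `z`.
  have hinner : ∀ z' : ℂ, z'.im ≠ 0 → deriv (fun w' : ℂ => covBracket α z' w' t s) w =
      (kConst α : ℂ)⁻¹ * ((∫ r in Ioi (0 : ℝ), ((r ^ (-(α / 2) - 1) : ℝ) : ℂ) *
        ((s * expFactorDeriv (rotatedStieltjes w) r s) * expFactor (rotatedStieltjes z') r t)) *
          rotatedStieltjesDeriv w) := by
    intro z' hz'
    have hd := hasDerivAt_integral_expFactor hβ1 hβ2
      (g := fun r => expFactor (rotatedStieltjes z') r t)
      ((continuous_expFactor _).comp (by fun_prop : Continuous fun r : ℝ => (r, t)))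
      (fun r hr => norm_expFactor_le (rotatedStieltjes_re_pos hz') hr.le ht)
      (rotatedStieltjes_re_pos hw) hs
    have hd2 := (HasDerivAt.comp w hd (hasDerivAt_rotatedStieltjes hw)).const_mul
      (kConst α : ℂ)⁻¹
    have hd3 := hd2.congr_of_eventuallyEq (f₁ := fun w' : ℂ => covBracket α z' w' t s)
      (by
        filter_upwards [eventually_im_ne_zero hw] with w' hw'
        rw [covBracket_eq hα hz' hw' ht hs]; rfl)
    rw [hd3.deriv, rotatedStieltjesDeriv]
    congr 3
    ext r; ring
  obtain ⟨C, hC⟩ := exists_norm_expFactorDeriv_le (rotatedStieltjes_re_pos hw) hs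
  have hd := hasDerivAt_integral_expFactor hβ1 hβ2 (C := s * C)
    (g := fun r => s * expFactorDeriv (rotatedStieltjes w) r s)
    (continuous_const.mul
      ((continuous_expFactorDeriv _).comp (by fun_prop : Continuous fun r : ℝ => (r, s))))
    (fun r hr => by
      rw [norm_mul, Complex.norm_real, Real.norm_of_nonneg hs.le, mul_assoc]
      exact mul_le_mul_of_nonneg_left (hC r hr) hs.le)
    (rotatedStieltjes_re_pos hz) ht
  have hd2 := ((HasDerivAt.comp z hd (hasDerivAt_rotatedStieltjes hz)).mul_const
      (rotatedStieltjesDeriv w)).const_mul (kConst α : ℂ)⁻¹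
  have hd3 := hd2.congr_of_eventuallyEq
    (f₁ := fun z' : ℂ => deriv (fun w' : ℂ => covBracket α z' w' t s) w)
    (by
      filter_upwards [eventually_im_ne_zero hz] with z' hz'
      rw [hinner z' hz']; rfl)
  rw [covIntegrand, hd3.deriv, ← rotatedStieltjesDeriv]
  have e : ∀ r : ℝ, ((r ^ (-(α / 2) - 1) : ℝ) : ℂ) * (s * expFactorDeriv (rotatedStieltjes w) r s *
      (t * expFactorDeriv (rotatedStieltjes z) r t)) = (s * t) * (((r ^ (-(α / 2) - 1) : ℝ) : ℂ) *
        (expFactorDeriv (rotatedStieltjes z) r t * expFactorDeriv (rotatedStieltjes w) r s)) := by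
    intro r; ring
  simp_rw [e]
  rw [integral_const_mul]
  have ht0 : (t : ℂ) ≠ 0 := by exact_mod_cast ht.ne'
  have hs0 : (s : ℂ) ≠ 0 := by exact_mod_cast hs.ne'
  have hk : (kConst α : ℂ) ≠ 0 := by exact_mod_cast (kConst_pos hα).ne'
  push_cast
  field_simp

/-- With `σ = sgn_z i` and `σ² = -1`, one has `u²κ + κ⁻¹ = -σ(1 - u²m²)/m` and `κ' = -σm²/(1 - m²)`,
so `σ` cancels and both half planes share one formula. -/
lemma rotatedStieltjesDeriv_mul_div {z : ℂ} (hz : z.im ≠ 0) {u : ℝ} (hu : 0 < u) :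
    rotatedStieltjesDeriv z * (2 * ((u ^ 2 : ℝ) : ℂ) /
      (((u ^ 2 : ℝ) : ℂ) * rotatedStieltjes z + (rotatedStieltjes z)⁻¹)) = lambdaResolvent u z := by
  have hD : ((u ^ 2 : ℝ) : ℂ) * rotatedStieltjes z + (rotatedStieltjes z)⁻¹ ≠ 0 := by
    intro h
    have := mul_add_inv_re_pos (rotatedStieltjes_re_pos hz) (show 0 < u ^ 2 by positivity)
    rw [h] at this; simp at this
  obtain ⟨h1, h2, h3⟩ := semicircleStieltjes_spec hz
  have hm2 := one_sub_sq_ne_zero h1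
  have hsign := sign_sq hz
  rw [rotatedStieltjesDeriv, lambdaResolvent]
  rw [rotatedStieltjes] at hD ⊢
  generalize semicircleStieltjes z = m at *
  generalize hσ : (Real.sign z.im : ℂ) * Complex.I = σ at *
  have hσ2 : σ ^ 2 = -1 := by rw [← hσ, mul_pow, hsign, Complex.I_sq]; ring
  have hσ0 : σ ≠ 0 := by rintro rfl; norm_num at hσ2
  have hσi : σ⁻¹ = -σ := inv_eq_of_mul_eq_one_right (by linear_combination -hσ2)
  have e : ((u ^ 2 : ℝ) : ℂ) * (σ * m) + (σ * m)⁻¹ = -σ * (1 - (u : ℂ) ^ 2 * m ^ 2) / m := by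
    rw [mul_inv, hσi]; push_cast; field_simp; ring
  rw [e] at hD ⊢
  have hp : 1 - (u : ℂ) ^ 2 * m ^ 2 ≠ 0 := by rintro h; rw [h] at hD; simp at hD
  generalize 1 - (u : ℂ) ^ 2 * m ^ 2 = p at *
  push_cast
  field_simp

/-- Absolute convergence of `C(z, w)`, and its value as an integral over `r`. -/
lemma covIntegrand_integrableOn_and_integral {c α : ℝ} (hα : α ∈ Ioo (2 : ℝ) 4) {z w : ℂ}
    (hz : z.im ≠ 0) (hw : w.im ≠ 0) :
    IntegrableOn (covIntegrand c α z w) (Ioi (0 : ℝ) ×ˢ Ioi (0 : ℝ)) ∧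
    resolventCov c α z w = ((2 * c / kConst α : ℝ) : ℂ) *
      ∫ u in Ioi (0 : ℝ), ((u ^ (-α - 1) : ℝ) : ℂ) *
        (lambdaResolvent u z * lambdaResolvent u w) := by
  have hβ1 : 0 < α / 2 := by linarith [hα.1]
  have hβ2 : α / 2 < 2 := by linarith [hα.2]
  obtain ⟨C₁, hC₁⟩ := exists_integral_norm_expFactorDeriv_le (rotatedStieltjes_re_pos hz)
  obtain ⟨C₂, hC₂⟩ := exists_integral_norm_expFactorDeriv_le (rotatedStieltjes_re_pos hw)
  have hF := integrable_integral_mul_and_integral_eq (μ := volume.restrict (Ioi (0 : ℝ)))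
    (ν₁ := volume.restrict (Ioi (0 : ℝ))) (ν₂ := volume.restrict (Ioi (0 : ℝ)))
    (w := fun r : ℝ => ((r ^ (-(α / 2) - 1) : ℝ) : ℂ))
    (g₁ := expFactorDeriv (rotatedStieltjes z)) (g₂ := expFactorDeriv (rotatedStieltjes w))
    (b₁ := fun r => C₁ * min 1 r) (b₂ := fun r => C₂ * min 1 r) (by fun_prop)
    (continuous_expFactorDeriv _).measurable (continuous_expFactorDeriv _).measurable
    ((ae_restrict_iff' measurableSet_Ioi).2 (Eventually.of_forall fun r hr =>
      ⟨integrableOn_expFactorDeriv (rotatedStieltjes_re_pos hz) hr, hC₁ r hr⟩))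
    ((ae_restrict_iff' measurableSet_Ioi).2 (Eventually.of_forall fun r hr =>
      ⟨integrableOn_expFactorDeriv (rotatedStieltjes_re_pos hw) hr, hC₂ r hr⟩))
    (by
      have := (integrableOn_min_sq_mul_rpow (n := 1) hβ1 (by simpa using hβ2)).const_mul (C₁ * C₂)
      refine IntegrableOn.congr_fun this (fun r hr => ?_) measurableSet_Ioi
      have hr' : 0 < r := hr
      rw [Complex.norm_real, Real.norm_of_nonneg (Real.rpow_nonneg hr'.le _), pow_one]
      ring)
  rw [Measure.prod_restrict, ← Measure.volume_eq_prod] at hF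
  set D : ℂ := ((c / kConst α : ℝ) : ℂ) * (rotatedStieltjesDeriv z * rotatedStieltjesDeriv w)
    with hD
  have hmeas : MeasurableSet (Ioi (0 : ℝ) ×ˢ Ioi (0 : ℝ)) :=
    measurableSet_Ioi.prod measurableSet_Ioi
  have hc : EqOn (fun p : ℝ × ℝ => D * ∫ r in Ioi (0 : ℝ), ((r ^ (-(α / 2) - 1) : ℝ) : ℂ) *
        (expFactorDeriv (rotatedStieltjes z) r p.1 * expFactorDeriv (rotatedStieltjes w) r p.2))
      (covIntegrand c α z w) (Ioi (0 : ℝ) ×ˢ Ioi (0 : ℝ)) := by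
    rintro ⟨t, s⟩ ⟨ht, hs⟩
    exact (covIntegrand_eq hα hz hw ht hs).symm
  refine ⟨IntegrableOn.congr_fun (hF.1.const_mul D) hc hmeas, ?_⟩
  rw [resolventCov, ← setIntegral_congr_fun hmeas hc, integral_const_mul, hF.2,
    ← integral_comp_rpow_Ioi_of_pos two_pos, ← integral_const_mul, ← integral_const_mul]
  refine setIntegral_congr_fun measurableSet_Ioi fun u hu => ?_
  have hu' : 0 < u := hu
  rw [Real.rpow_two, integral_expFactorDeriv (rotatedStieltjes_re_pos hz) (by positivity),
    integral_expFactorDeriv (rotatedStieltjes_re_pos hw) (by positivity),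
    ← rotatedStieltjesDeriv_mul_div hz hu', ← rotatedStieltjesDeriv_mul_div hw hu', hD]
  -- The substitution `r = u²` turns `r^(-α/2-1) dr` into `2u^(-α-1) du`, the source of the factor
  -- `2` in the kernel constant.
  have hpow : 2 * u ^ ((2 : ℝ) - 1) * (u ^ 2) ^ (-(α / 2) - 1) = 2 * u ^ (-α - 1) := by
    rw [← Real.rpow_natCast u 2, ← Real.rpow_mul hu'.le, mul_assoc, ← Real.rpow_add hu']
    congr 2; push_cast; ring
  have hpow' : ((2 * u ^ ((2 : ℝ) - 1) : ℝ) : ℂ) * (((u ^ 2) ^ (-(α / 2) - 1) : ℝ) : ℂ) =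
      2 * ((u ^ (-α - 1) : ℝ) : ℂ) := by
    rw [← Complex.ofReal_mul, hpow]; push_cast; ring
  rw [Complex.real_smul]
  generalize rotatedStieltjesDeriv z = a1
  generalize rotatedStieltjesDeriv w = a2
  generalize 2 * ((u ^ 2 : ℝ) : ℂ) / _ = a3
  generalize 2 * ((u ^ 2 : ℝ) : ℂ) / _ = a4
  push_cast at hpow' ⊢
  linear_combination (c / kConst α : ℂ) * a1 * a2 * a3 * a4 * hpow'

/-! ### Cauchy averages -/

/-- The convolution of `ψ` with the Cauchy density of scale `η`. -/
def cauchyAverage (η : ℝ) (ψ : ℝ → ℂ) (x : ℝ) : ℂ :=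
  ∫ y : ℝ, ((π⁻¹ * (1 + y ^ 2)⁻¹ : ℝ) : ℂ) * ψ (x + η * y)

lemma integrable_cauchyDensity : Integrable fun y : ℝ => π⁻¹ * (1 + y ^ 2)⁻¹ :=
  integrable_inv_one_add_sq.const_mul _

lemma integral_cauchyDensity : ∫ y : ℝ, π⁻¹ * (1 + y ^ 2)⁻¹ = 1 := by
  rw [integral_const_mul, integral_univ_inv_one_add_sq, inv_mul_cancel₀ Real.pi_ne_zero]

lemma norm_cauchyDensity_mul_le (ψ : ℝ →ᵇ ℂ) (x y : ℝ) :
    ‖((π⁻¹ * (1 + y ^ 2)⁻¹ : ℝ) : ℂ) * ψ x‖ ≤ π⁻¹ * (1 + y ^ 2)⁻¹ * ‖ψ‖ := by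
  rw [norm_mul, Complex.norm_real, Real.norm_of_nonneg (by positivity)]
  exact mul_le_mul_of_nonneg_left (ψ.norm_coe_le_norm x) (by positivity)

lemma norm_cauchyAverage_le (η : ℝ) (ψ : ℝ →ᵇ ℂ) (x : ℝ) : ‖cauchyAverage η ψ x‖ ≤ ‖ψ‖ := by
  calc _ ≤ ∫ y : ℝ, π⁻¹ * (1 + y ^ 2)⁻¹ * ‖ψ‖ :=
        norm_integral_le_of_norm_le (integrable_cauchyDensity.mul_const _)
          (Eventually.of_forall fun y => norm_cauchyDensity_mul_le ψ _ y)
    _ = ‖ψ‖ := by rw [integral_mul_const, integral_cauchyDensity, one_mul]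

lemma measurable_cauchyAverage (η : ℝ) (ψ : ℝ →ᵇ ℂ) : Measurable (cauchyAverage η ψ) := by
  have hψ := ψ.continuous
  have h : Measurable fun p : ℝ × ℝ => ((π⁻¹ * (1 + p.2 ^ 2)⁻¹ : ℝ) : ℂ) * ψ (p.1 + η * p.2) :=
    Measurable.mul (by fun_prop) (hψ.comp (by fun_prop)).measurable
  exact h.stronglyMeasurable.integral_prod_right'.measurable

lemma tendsto_cauchyAverage (ψ : ℝ →ᵇ ℂ) (x : ℝ) :
    Tendsto (fun η => cauchyAverage η ψ x) (𝓝[>] 0) (𝓝 (ψ x)) := by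
  have hψ := ψ.continuous
  have hx : ψ x = ∫ y : ℝ, ((π⁻¹ * (1 + y ^ 2)⁻¹ : ℝ) : ℂ) * ψ x := by
    rw [integral_mul_const, integral_complex_ofReal, integral_cauchyDensity, Complex.ofReal_one,
      one_mul]
  rw [hx]
  refine tendsto_integral_filter_of_dominated_convergence
    (fun y : ℝ => π⁻¹ * (1 + y ^ 2)⁻¹ * ‖ψ‖) ?_ ?_ (integrable_cauchyDensity.mul_const _) ?_
  · refine Eventually.of_forall fun η => Measurable.aestronglyMeasurable ?_
    exact Measurable.mul (by fun_prop) (hψ.comp (by fun_prop)).measurable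
  · exact Eventually.of_forall fun η => Eventually.of_forall fun y =>
      norm_cauchyDensity_mul_le ψ _ y
  · refine Eventually.of_forall fun y => Tendsto.const_mul _ ?_
    have : Continuous fun η : ℝ => ψ (x + η * y) := hψ.comp (by fun_prop)
    have h2 := this.tendsto 0
    simp only [zero_mul, add_zero] at h2
    exact h2.mono_left nhdsWithin_le_nhds

/-- The Poisson kernel of the half plane, up to the factor `π⁻¹`. -/
def halfPlanePoisson (η y : ℝ) : ℝ := η / (y ^ 2 + η ^ 2)

lemma halfPlanePoisson_nonneg {η : ℝ} (hη : 0 < η) (y : ℝ) : 0 ≤ halfPlanePoisson η y := by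
  unfold halfPlanePoisson; positivity

lemma continuous_halfPlanePoisson {η : ℝ} (hη : 0 < η) : Continuous (halfPlanePoisson η) := by
  unfold halfPlanePoisson
  exact Continuous.div continuous_const (by fun_prop) (fun y => by positivity)

section
variable {E : Type*} [NormedAddCommGroup E] [NormedSpace ℝ E]

lemma integral_comp_add_mul (g : ℝ → E) {η : ℝ} (hη : 0 < η) (x : ℝ) :
    ∫ y, g y = ∫ y, η • g (x + η * y) := by
  rw [integral_smul, Measure.integral_comp_mul_left (fun y => g (x + y)),
    abs_of_pos (inv_pos.2 hη), smul_smul, mul_inv_cancel₀ hη.ne', one_smul,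
    integral_add_left_eq_self]

end

lemma smul_halfPlanePoisson {η : ℝ} (hη : 0 < η) (x y : ℝ) :
    η * halfPlanePoisson η (x + η * y - x) = (1 + y ^ 2)⁻¹ := by
  rw [halfPlanePoisson, add_sub_cancel_left]
  have : (η * y) ^ 2 + η ^ 2 = η ^ 2 * (1 + y ^ 2) := by ring
  have h2 : 0 < 1 + y ^ 2 := by positivity
  rw [this]
  field_simp

lemma integral_halfPlanePoisson_sub {η : ℝ} (hη : 0 < η) (x : ℝ) :
    ∫ y, halfPlanePoisson η (y - x) = π := by
  rw [integral_comp_add_mul _ hη x]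
  simp_rw [smul_eq_mul, smul_halfPlanePoisson hη]
  exact integral_univ_inv_one_add_sq

lemma integrable_halfPlanePoisson_sub {η : ℝ} (hη : 0 < η) (x : ℝ) :
    Integrable fun y => halfPlanePoisson η (y - x) := by
  -- A non-integrable function has integral `0` by convention, but this integral is `π`.
  by_contra h
  have := integral_halfPlanePoisson_sub hη x
  rw [integral_undef h] at this
  exact Real.pi_ne_zero this.symm

lemma integral_halfPlanePoisson_mul {η : ℝ} (hη : 0 < η) (ψ : ℝ → ℂ) (x : ℝ) :
    ∫ y, (halfPlanePoisson η (y - x) : ℂ) * ψ y = π * cauchyAverage η ψ x := by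
  rw [integral_comp_add_mul _ hη x, cauchyAverage, ← integral_const_mul]
  congr 1; ext y
  rw [Complex.real_smul, ← mul_assoc, ← Complex.ofReal_mul, smul_halfPlanePoisson hη, ← mul_assoc,
    ← Complex.ofReal_mul, ← mul_assoc, mul_inv_cancel₀ Real.pi_ne_zero, one_mul]

/-! ### The jump of the resolvent transform of `Λ_u` -/

lemma add_mul_I_im (E η : ℝ) : ((E : ℂ) + (η : ℂ) * Complex.I).im = η := by simp

lemma conj_add_mul_I_im (E η : ℝ) : (conj ((E : ℂ) + (η : ℂ) * Complex.I)).im = -η := by simp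

/-- The jump of `lambdaResolvent u` between the heights `η` and `-η`. -/
def lambdaJump (u η E : ℝ) : ℂ :=
  lambdaResolvent u ((E : ℂ) + (η : ℂ) * Complex.I) -
    lambdaResolvent u (conj ((E : ℂ) + (η : ℂ) * Complex.I))

lemma measurable_inv_sub_ofReal (z : ℂ) : Measurable fun x : ℝ => (z - (x : ℂ))⁻¹ := by fun_prop

lemma norm_inv_sub_ofReal_le {z : ℂ} (hz : z.im ≠ 0) (x : ℝ) : ‖(z - (x : ℂ))⁻¹‖ ≤ |z.im|⁻¹ := by
  rw [norm_inv]
  have h1 : |z.im| ≤ ‖z - (x : ℂ)‖ := by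
    have := Complex.abs_im_le_norm (z - (x : ℂ))
    simpa using this
  have := abs_pos.2 hz
  gcongr

lemma norm_lambdaResolvent_le {u : ℝ} (hu : 0 < u) (hu1 : u ≠ 1) {z : ℂ} (hz : z.im ≠ 0) :
    ‖lambdaResolvent u z‖ ≤ 12 * min 1 (u ^ 2) * |z.im|⁻¹ := by
  rw [← lambdaApply_resolvent hu hu1 hz]
  exact norm_lambdaApply_le hu hu1 (measurable_inv_sub_ofReal z) (norm_inv_sub_ofReal_le hz)

lemma inv_sub_sub_inv_conj_sub {η : ℝ} (hη : 0 < η) (E x : ℝ) :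
    ((E : ℂ) + (η : ℂ) * Complex.I - x)⁻¹ - (conj ((E : ℂ) + (η : ℂ) * Complex.I) - x)⁻¹ =
      -2 * Complex.I * (halfPlanePoisson η (E - x) : ℂ) := by
  have h1 := sub_ofReal_ne_zero (z := (E : ℂ) + (η : ℂ) * Complex.I)
    (by rw [add_mul_I_im]; exact hη.ne') x
  have h2 := sub_ofReal_ne_zero (z := conj ((E : ℂ) + (η : ℂ) * Complex.I))
    (by rw [conj_add_mul_I_im]; exact (neg_neg_of_pos hη).ne) x
  have h3 : (E - x) ^ 2 + η ^ 2 ≠ 0 := by positivity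
  have h3' : ((E : ℂ) - x) ^ 2 + (η : ℂ) ^ 2 ≠ 0 := by exact_mod_cast h3
  rw [halfPlanePoisson]
  simp only [map_add, map_mul, Complex.conj_ofReal, Complex.conj_I] at h2 ⊢
  push_cast
  rw [inv_sub_inv h1 h2, mul_div_assoc', div_eq_div_iff (mul_ne_zero h1 h2) h3']
  ring_nf
  simp only [Complex.I_pow_three]
  ring

lemma lambdaJump_eq {u η : ℝ} (hu : 0 < u) (hu1 : u ≠ 1) (hη : 0 < η) (E : ℝ) :
    lambdaJump u η E = -2 * Complex.I *
      ∫ x, (lambdaWeight u x : ℂ) * (halfPlanePoisson η (E - x) : ℂ) ∂(lambdaBase u) := by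
  have h1 : ((E : ℂ) + (η : ℂ) * Complex.I).im ≠ 0 := by rw [add_mul_I_im]; exact hη.ne'
  have h2 : (conj ((E : ℂ) + (η : ℂ) * Complex.I)).im ≠ 0 := by
    rw [conj_add_mul_I_im]; exact (neg_neg_of_pos hη).ne
  have m1 := measurable_inv_sub_ofReal ((E : ℂ) + (η : ℂ) * Complex.I)
  have m2 := measurable_inv_sub_ofReal (conj ((E : ℂ) + (η : ℂ) * Complex.I))
  have b1 := norm_inv_sub_ofReal_le h1
  have b2 := norm_inv_sub_ofReal_le h2
  rw [lambdaJump, ← lambdaApply_resolvent hu hu1 h1, ← lambdaApply_resolvent hu hu1 h2,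
    lambdaApply_eq hu hu1 m1 b1, lambdaApply_eq hu hu1 m2 b2,
    ← integral_sub (integrable_lambdaWeight_mul hu m1 b1) (integrable_lambdaWeight_mul hu m2 b2),
    ← integral_const_mul]
  congr 1; ext x
  rw [← mul_sub, inv_sub_sub_inv_conj_sub hη]
  ring

lemma integrable_weight_mul_poisson {u η : ℝ} (hu : 0 < u) (hη : 0 < η) (ψ : ℝ →ᵇ ℂ) :
    Integrable (fun p : ℝ × ℝ => (lambdaWeight u p.1 : ℂ) *
      ((halfPlanePoisson η (p.2 - p.1) : ℂ) * ψ p.2)) ((lambdaBase u).prod volume) ∧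
    ∫ x, (∫ E, ‖(lambdaWeight u x : ℂ) * ((halfPlanePoisson η (E - x) : ℂ) * ψ E)‖)
      ∂(lambdaBase u) ≤ (∫ x, |lambdaWeight u x| ∂(lambdaBase u)) * (π * ‖ψ‖) := by
  have hψ := ψ.continuous
  have hP := continuous_halfPlanePoisson hη
  have hm : Measurable fun p : ℝ × ℝ => (lambdaWeight u p.1 : ℂ) *
      ((halfPlanePoisson η (p.2 - p.1) : ℂ) * ψ p.2) := by
    refine Measurable.mul ?_ (Measurable.mul ?_ ?_)
    · exact Complex.measurable_ofReal.comp ((measurable_lambdaWeight u).comp measurable_fst)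
    · exact (Complex.continuous_ofReal.comp (hP.comp (by fun_prop))).measurable
    · exact hψ.measurable.comp measurable_snd
  have hI : ∀ x : ℝ, Integrable fun E => (halfPlanePoisson η (E - x) : ℂ) * ψ E := fun x =>
    (integrable_halfPlanePoisson_sub hη x).ofReal.mul_bdd hψ.aestronglyMeasurable
      (Eventually.of_forall ψ.norm_coe_le_norm)
  have hb : ∀ x : ℝ, ∫ E, ‖(lambdaWeight u x : ℂ) * ((halfPlanePoisson η (E - x) : ℂ) * ψ E)‖ ≤
      |lambdaWeight u x| * (π * ‖ψ‖) := by
    intro x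
    calc _ ≤ ∫ E, |lambdaWeight u x| * (halfPlanePoisson η (E - x) * ‖ψ‖) := by
          refine integral_mono ((hI x).const_mul _).norm
            (((integrable_halfPlanePoisson_sub hη x).mul_const _).const_mul _) fun E => ?_
          simp only
          rw [norm_mul, norm_mul, Complex.norm_real, Complex.norm_real, Real.norm_eq_abs,
            Real.norm_of_nonneg (halfPlanePoisson_nonneg hη _)]
          have := halfPlanePoisson_nonneg hη (E - x)
          have := ψ.norm_coe_le_norm E
          gcongr
      _ = _ := by
          rw [integral_const_mul, integral_mul_const, integral_halfPlanePoisson_sub hη]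
  have hbi : Integrable (fun x => |lambdaWeight u x| * (π * ‖ψ‖)) (lambdaBase u) :=
    (integrable_lambdaWeight hu).abs.mul_const _
  have hni : Integrable (fun x => ∫ E, ‖(lambdaWeight u x : ℂ) *
      ((halfPlanePoisson η (E - x) : ℂ) * ψ E)‖) (lambdaBase u) := by
    refine Integrable.mono' hbi hm.aestronglyMeasurable.norm.integral_prod_right' ?_
    refine Eventually.of_forall fun x => ?_
    rw [Real.norm_of_nonneg (integral_nonneg fun _ => norm_nonneg _)]
    exact hb x
  constructor
  · rw [integrable_prod_iff hm.aestronglyMeasurable]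
    exact ⟨Eventually.of_forall fun x => (hI x).const_mul (lambdaWeight u x : ℂ), hni⟩
  · refine (integral_mono hni hbi hb).trans_eq ?_
    rw [integral_mul_const]

/-- Fubini, together with the evenness of the Poisson kernel, moves the smoothing from `Λ_u` onto
`ψ`. The constant `24π` is `2` from the jump, `12` from the variation of `Λ_u` and `π` from the
kernel. -/
lemma lambdaJump_mul_spec {u η : ℝ} (hu : 0 < u) (hu1 : u ≠ 1) (hη : 0 < η) (ψ : ℝ →ᵇ ℂ) :
    Integrable (fun E => lambdaJump u η E * ψ E) ∧
    ∫ E, ‖lambdaJump u η E * ψ E‖ ≤ 24 * π * ‖ψ‖ * min 1 (u ^ 2) ∧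
    ∫ E, lambdaJump u η E * ψ E = -2 * Complex.I * π * lambdaApply u (cauchyAverage η ψ) := by
  obtain ⟨hi, hle⟩ := integrable_weight_mul_poisson hu hη ψ
  have he : ∀ E, lambdaJump u η E * ψ E = -2 * Complex.I * ∫ x, (lambdaWeight u x : ℂ) *
      ((halfPlanePoisson η (E - x) : ℂ) * ψ E) ∂(lambdaBase u) := by
    intro E
    rw [lambdaJump_eq hu hu1 hη, mul_assoc, ← integral_mul_const]
    simp_rw [mul_assoc]
  simp_rw [he]
  have hw := integral_abs_lambdaWeight_le hu hu1
  refine ⟨hi.integral_prod_right.const_mul _, ?_, ?_⟩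
  · have n2 : ‖-2 * Complex.I‖ = 2 := by simp
    simp_rw [norm_mul (-2 * Complex.I), n2]
    rw [integral_const_mul]
    have h1 : ∫ E, ‖∫ x, (lambdaWeight u x : ℂ) *
        ((halfPlanePoisson η (E - x) : ℂ) * ψ E) ∂(lambdaBase u)‖ ≤
        ∫ E, ∫ x, ‖(lambdaWeight u x : ℂ) *
        ((halfPlanePoisson η (E - x) : ℂ) * ψ E)‖ ∂(lambdaBase u) :=
      integral_mono hi.integral_prod_right.norm hi.norm.integral_prod_right
        fun E => norm_integral_le_integral_norm _
    have h2 := integral_integral_swap (f := fun (x E : ℝ) => ‖(lambdaWeight u x : ℂ) *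
        ((halfPlanePoisson η (E - x) : ℂ) * ψ E)‖) hi.norm
    rw [← h2] at h1
    have h3 : (∫ x, |lambdaWeight u x| ∂(lambdaBase u)) * (π * ‖ψ‖) ≤
      12 * min 1 (u ^ 2) * (π * ‖ψ‖) := by gcongr
    linarith
  · have h2 := integral_integral_swap (f := fun (x E : ℝ) => (lambdaWeight u x : ℂ) *
        ((halfPlanePoisson η (E - x) : ℂ) * ψ E)) hi
    rw [integral_const_mul, ← h2, lambdaApply_eq hu hu1 (measurable_cauchyAverage η ψ)
      (norm_cauchyAverage_le η ψ)]
    simp_rw [integral_const_mul, integral_halfPlanePoisson_mul hη]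
    rw [mul_assoc (-2 * Complex.I), ← integral_const_mul (π : ℂ)]
    congr 2; ext x; ring

lemma measurable_uncurry_lambdaResolvent {g : ℝ → ℂ}
    (h : Continuous fun E => semicircleStieltjes (g E)) :
    Measurable fun p : ℝ × ℝ => lambdaResolvent p.1 (g p.2) := by
  have hm : Measurable fun p : ℝ × ℝ => semicircleStieltjes (g p.2) :=
    h.measurable.comp measurable_snd
  have hu : Measurable fun p : ℝ × ℝ => (p.1 : ℂ) ^ 2 := by fun_prop
  unfold lambdaResolvent
  exact ((hu.const_mul 2).mul (hm.pow_const 3)).div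
    (((hm.pow_const 2).const_sub 1).mul ((hu.mul (hm.pow_const 2)).const_sub 1))

lemma measurable_uncurry_lambdaJump {η : ℝ} (hη : 0 < η) :
    Measurable fun p : ℝ × ℝ => lambdaJump p.1 η p.2 := by
  refine Measurable.sub
    (measurable_uncurry_lambdaResolvent (g := fun E : ℝ => (E : ℂ) + (η : ℂ) * Complex.I) ?_)
    (measurable_uncurry_lambdaResolvent (g := fun E : ℝ => conj ((E : ℂ) + (η : ℂ) * Complex.I)) ?_)
  · refine continuous_iff_continuousAt.2 fun E => ContinuousAt.comp (g := semicircleStieltjes)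
      (continuousAt_semicircleStieltjes (by rw [add_mul_I_im]; exact hη.ne'))
      (by fun_prop)
  · refine continuous_iff_continuousAt.2 fun E => ContinuousAt.comp (g := semicircleStieltjes)
      (continuousAt_semicircleStieltjes (by rw [conj_add_mul_I_im]; exact (neg_neg_of_pos hη).ne))
      (Complex.continuous_conj.comp (by fun_prop)).continuousAt

/-! ### The pairings -/

/-- The identities for `Λ_u` break down at `u = 1`, where its atoms meet the endpoints; a single
value of `u` is negligible. -/
lemma ae_Ioi_pos_ne_one : ∀ᵐ u ∂(volume.restrict (Ioi (0 : ℝ))), 0 < u ∧ u ≠ 1 := by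
  refine (ae_restrict_iff' measurableSet_Ioi).2 ?_
  filter_upwards [Measure.ae_ne volume (1 : ℝ)] with u h1 h0
  exact ⟨h0, h1⟩

lemma integrableOn_rpow_mul_min_sq {α : ℝ} (hα : α ∈ Ioo (2 : ℝ) 4) :
    IntegrableOn (fun u : ℝ => (min 1 (u ^ 2)) ^ 2 * u ^ (-α - 1)) (Ioi 0) :=
  integrableOn_min_sq_mul_rpow (by linarith [hα.1]) (by norm_num; exact hα.2)

lemma integrableOn_lambdaResolvent_mul {α : ℝ} (hα : α ∈ Ioo (2 : ℝ) 4) {z w : ℂ}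
    (hz : z.im ≠ 0) (hw : w.im ≠ 0) :
    IntegrableOn (fun u : ℝ => ((u ^ (-α - 1) : ℝ) : ℂ) *
        (lambdaResolvent u z * lambdaResolvent u w)) (Ioi 0) := by
  refine Integrable.mono' ((integrableOn_rpow_mul_min_sq hα).const_mul
    (144 * |z.im|⁻¹ * |w.im|⁻¹)) ?_ ?_
  · unfold lambdaResolvent
    exact Measurable.aestronglyMeasurable (by fun_prop)
  · filter_upwards [ae_Ioi_pos_ne_one] with u hu
    rw [norm_mul, norm_mul, Complex.norm_real, Real.norm_of_nonneg (Real.rpow_nonneg hu.1.le _)]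
    have h1 := norm_lambdaResolvent_le hu.1 hu.2 hz
    have h2 := norm_lambdaResolvent_le hu.1 hu.2 hw
    have h3 := Real.rpow_nonneg hu.1.le (-α - 1)
    calc _ ≤ u ^ (-α - 1) *
        ((12 * min 1 (u ^ 2) * |z.im|⁻¹) * (12 * min 1 (u ^ 2) * |w.im|⁻¹)) := by
          gcongr
      _ = _ := by ring

/-- The four terms are the expansion of a product of two differences, so the jump factorizes under
the `u`-integral. -/
lemma covJump_eq {c α : ℝ} (hα : α ∈ Ioo (2 : ℝ) 4) {η₁ η₂ : ℝ} (h₁ : 0 < η₁) (h₂ : 0 < η₂)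
    (E F : ℝ) :
    covJump c α ((E : ℂ) + (η₁ : ℂ) * Complex.I) ((F : ℂ) + (η₂ : ℂ) * Complex.I) =
      ((2 * c / kConst α : ℝ) : ℂ) * ∫ u in Ioi (0 : ℝ), ((u ^ (-α - 1) : ℝ) : ℂ) *
        (lambdaJump u η₁ E * lambdaJump u η₂ F) := by
  have a1 : ((E : ℂ) + (η₁ : ℂ) * Complex.I).im ≠ 0 := by rw [add_mul_I_im]; exact h₁.ne'
  have a2 : (conj ((E : ℂ) + (η₁ : ℂ) * Complex.I)).im ≠ 0 := by
    rw [conj_add_mul_I_im]; exact (neg_neg_of_pos h₁).ne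
  have a3 : ((F : ℂ) + (η₂ : ℂ) * Complex.I).im ≠ 0 := by rw [add_mul_I_im]; exact h₂.ne'
  have a4 : (conj ((F : ℂ) + (η₂ : ℂ) * Complex.I)).im ≠ 0 := by
    rw [conj_add_mul_I_im]; exact (neg_neg_of_pos h₂).ne
  rw [covJump]
  simp only [lambdaJump]
  generalize (E : ℂ) + (η₁ : ℂ) * Complex.I = z at *
  generalize (F : ℂ) + (η₂ : ℂ) * Complex.I = w at *
  rw [(covIntegrand_integrableOn_and_integral hα a1 a3).2,
    (covIntegrand_integrableOn_and_integral hα a2 a4).2,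
    (covIntegrand_integrableOn_and_integral hα a2 a3).2,
    (covIntegrand_integrableOn_and_integral hα a1 a4).2]
  have i13 := integrableOn_lambdaResolvent_mul hα a1 a3
  have i24 := integrableOn_lambdaResolvent_mul hα a2 a4
  have i23 := integrableOn_lambdaResolvent_mul hα a2 a3
  have i14 := integrableOn_lambdaResolvent_mul hα a1 a4
  have s1 := integral_add i13 i24
  have s2 := integral_sub (i13.add i24) i23
  have s3 := integral_sub ((i13.add i24).sub i23) i14
  simp only [Pi.add_apply, Pi.sub_apply] at s1 s2 s3
  rw [← mul_add, ← mul_sub, ← mul_sub, ← s1, ← s2, ← s3]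
  congr 2; ext u
  ring

lemma measurable_lambdaApply {ψ : ℝ → ℂ} (hψ : Measurable ψ) :
    Measurable fun u => lambdaApply u ψ := by
  unfold lambdaApply
  refine Measurable.add ?_ (Measurable.ite measurableSet_Ici ?_ measurable_const)
  · have h : Measurable fun p : ℝ × ℝ => (lambdaDensity p.1 p.2 : ℂ) * ψ p.2 := by
      refine Measurable.mul ?_ (hψ.comp measurable_snd)
      unfold lambdaDensity; fun_prop
    exact h.stronglyMeasurable.integral_prod_right'.measurable
  · fun_prop

lemma measurable_kernelIntegrand (α : ℝ) {ψ φ : ℝ → ℂ} (hψ : Measurable ψ) (hφ : Measurable φ) :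
    Measurable (kernelIntegrand α ψ φ) := by
  unfold kernelIntegrand
  exact ((measurable_lambdaApply hψ).mul (measurable_lambdaApply hφ)).div (by fun_prop)

lemma kernelIntegrand_eq (α : ℝ) (ψ φ : ℝ → ℂ) {u : ℝ} (hu : 0 < u) :
    kernelIntegrand α ψ φ u =
      ((u ^ (-α - 1) : ℝ) : ℂ) * (lambdaApply u ψ * lambdaApply u φ) := by
  rw [kernelIntegrand, show -α - 1 = -(1 + α) by ring, Real.rpow_neg hu.le, Complex.ofReal_inv,
    div_eq_inv_mul]

lemma norm_kernelIntegrand_le (α : ℝ) {ψ φ : ℝ → ℂ} (hψ : Measurable ψ) (hφ : Measurable φ)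
    {B C : ℝ} (hB : ∀ x, ‖ψ x‖ ≤ B) (hC : ∀ x, ‖φ x‖ ≤ C) {u : ℝ} (hu : 0 < u) (hu1 : u ≠ 1) :
    ‖kernelIntegrand α ψ φ u‖ ≤ 144 * B * C * ((min 1 (u ^ 2)) ^ 2 * u ^ (-α - 1)) := by
  rw [kernelIntegrand_eq α ψ φ hu, norm_mul, norm_mul, Complex.norm_real,
    Real.norm_of_nonneg (Real.rpow_nonneg hu.le _)]
  have h1 := norm_lambdaApply_le hu hu1 hψ hB
  have h2 := norm_lambdaApply_le hu hu1 hφ hC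
  have h3 := Real.rpow_nonneg hu.le (-α - 1)
  have hB0 : 0 ≤ B := (norm_nonneg _).trans (hB 0)
  calc _ ≤ u ^ (-α - 1) * ((12 * min 1 (u ^ 2) * B) * (12 * min 1 (u ^ 2) * C)) := by
        gcongr
    _ = _ := by ring

lemma integrableOn_kernelIntegrand {α : ℝ} (hα : α ∈ Ioo (2 : ℝ) 4) {ψ φ : ℝ → ℂ}
    (hψ : Measurable ψ) (hφ : Measurable φ) {B C : ℝ} (hB : ∀ x, ‖ψ x‖ ≤ B)
    (hC : ∀ x, ‖φ x‖ ≤ C) : IntegrableOn (kernelIntegrand α ψ φ) (Ioi 0) := by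
  refine Integrable.mono' ((integrableOn_rpow_mul_min_sq hα).const_mul (144 * B * C))
    (measurable_kernelIntegrand α hψ hφ).aestronglyMeasurable ?_
  filter_upwards [ae_Ioi_pos_ne_one] with u hu
  exact norm_kernelIntegrand_le α hψ hφ hB hC hu.1 hu.2

/-- An exact identity at fixed heights: the prefactor `-1/(4π²)` cancels the `(-2πi)²` coming from
the two jumps. -/
lemma regularizedPairing_spec {c α : ℝ} (hα : α ∈ Ioo (2 : ℝ) 4) (ψ φ : ℝ →ᵇ ℂ) {η₁ η₂ : ℝ}
    (h₁ : 0 < η₁) (h₂ : 0 < η₂) :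
    Integrable (pairingIntegrand c α ψ φ η₁ η₂) ∧
    regularizedPairing c α ψ φ η₁ η₂ =
      kernelPairing c α (cauchyAverage η₁ ψ) (cauchyAverage η₂ φ) := by
  have hF := integrable_integral_mul_and_integral_eq (μ := volume.restrict (Ioi (0 : ℝ)))
    (ν₁ := (volume : Measure ℝ)) (ν₂ := (volume : Measure ℝ))
    (w := fun u : ℝ => ((u ^ (-α - 1) : ℝ) : ℂ))
    (g₁ := fun u E => lambdaJump u η₁ E * ψ E) (g₂ := fun u F => lambdaJump u η₂ F * φ F)
    (b₁ := fun u => 24 * π * ‖ψ‖ * min 1 (u ^ 2)) (b₂ := fun u => 24 * π * ‖φ‖ * min 1 (u ^ 2))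
    (by fun_prop)
    ((measurable_uncurry_lambdaJump h₁).mul (ψ.continuous.measurable.comp measurable_snd))
    ((measurable_uncurry_lambdaJump h₂).mul (φ.continuous.measurable.comp measurable_snd))
    (by
      filter_upwards [ae_Ioi_pos_ne_one] with u hu
      have := lambdaJump_mul_spec hu.1 hu.2 h₁ ψ
      exact ⟨this.1, this.2.1⟩)
    (by
      filter_upwards [ae_Ioi_pos_ne_one] with u hu
      have := lambdaJump_mul_spec hu.1 hu.2 h₂ φ
      exact ⟨this.1, this.2.1⟩)
    (by
      have := (integrableOn_rpow_mul_min_sq hα).const_mul ((24 * π * ‖ψ‖) * (24 * π * ‖φ‖))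
      refine IntegrableOn.congr_fun this (fun u hu => ?_) measurableSet_Ioi
      have hu' : 0 < u := hu
      rw [Complex.norm_real, Real.norm_of_nonneg (Real.rpow_nonneg hu'.le _)]
      ring)
  rw [← Measure.volume_eq_prod] at hF
  have hp : pairingIntegrand c α ψ φ η₁ η₂ = fun p : ℝ × ℝ => ((2 * c / kConst α : ℝ) : ℂ) *
      ∫ u in Ioi (0 : ℝ), ((u ^ (-α - 1) : ℝ) : ℂ) *
        ((lambdaJump u η₁ p.1 * ψ p.1) * (lambdaJump u η₂ p.2 * φ p.2)) := by
    ext p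
    rw [pairingIntegrand, covJump_eq hα h₁ h₂, mul_assoc, ← integral_mul_const]
    congr 2; ext u; ring
  refine ⟨by rw [hp]; exact hF.1.const_mul _, ?_⟩
  rw [regularizedPairing, hp, integral_const_mul, hF.2, kernelPairing, mul_left_comm,
    ← integral_const_mul]
  congr 1
  refine integral_congr_ae ?_
  filter_upwards [ae_Ioi_pos_ne_one] with u hu
  rw [(lambdaJump_mul_spec hu.1 hu.2 h₁ ψ).2.2, (lambdaJump_mul_spec hu.1 hu.2 h₂ φ).2.2,
    kernelIntegrand_eq _ _ _ hu.1]
  have hpi : (π : ℂ) ≠ 0 := by exact_mod_cast Real.pi_ne_zero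
  generalize lambdaApply u _ = a
  generalize lambdaApply u _ = b
  generalize ((u ^ (-α - 1) : ℝ) : ℂ) = d
  field_simp
  rw [Complex.I_sq]
  ring

lemma tendsto_lambdaApply_cauchyAverage {u : ℝ} (hu : 0 < u) (hu1 : u ≠ 1) (ψ : ℝ →ᵇ ℂ) :
    Tendsto (fun η => lambdaApply u (cauchyAverage η ψ)) (𝓝[>] 0) (𝓝 (lambdaApply u ψ)) := by
  rw [lambdaApply_eq hu hu1 ψ.continuous.measurable ψ.norm_coe_le_norm]
  simp_rw [fun η => lambdaApply_eq hu hu1 (measurable_cauchyAverage η ψ)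
    (norm_cauchyAverage_le η ψ)]
  refine tendsto_integral_filter_of_dominated_convergence (fun x => |lambdaWeight u x| * ‖ψ‖)
    (Eventually.of_forall fun η => (integrable_lambdaWeight_mul hu
      (measurable_cauchyAverage η ψ) (norm_cauchyAverage_le η ψ)).aestronglyMeasurable)
    (Eventually.of_forall fun η => Eventually.of_forall fun x => ?_)
    ((integrable_lambdaWeight hu).abs.mul_const _)
    (Eventually.of_forall fun x => (tendsto_cauchyAverage ψ x).const_mul _)
  rw [norm_mul, Complex.norm_real, Real.norm_eq_abs]
  exact mul_le_mul_of_nonneg_left (norm_cauchyAverage_le η ψ x) (abs_nonneg _)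

/-- Cauchy averaging does not increase the sup norm, so one majorant in `u` serves all `η₁, η₂`;
this is why the limit may be taken jointly. -/
lemma tendsto_kernelPairing_cauchyAverage {c α : ℝ} (hα : α ∈ Ioo (2 : ℝ) 4) (ψ φ : ℝ →ᵇ ℂ) :
    Tendsto (fun η : ℝ × ℝ => kernelPairing c α (cauchyAverage η.1 ψ) (cauchyAverage η.2 φ))
      (𝓝[>] (0 : ℝ) ×ˢ 𝓝[>] (0 : ℝ)) (𝓝 (kernelPairing c α ψ φ)) := by
  unfold kernelPairing
  refine Tendsto.const_mul _ ?_
  refine tendsto_integral_filter_of_dominated_convergence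
    (fun u => 144 * ‖ψ‖ * ‖φ‖ * ((min 1 (u ^ 2)) ^ 2 * u ^ (-α - 1)))
    (Eventually.of_forall fun η => (measurable_kernelIntegrand α (measurable_cauchyAverage _ ψ)
      (measurable_cauchyAverage _ φ)).aestronglyMeasurable)
    (Eventually.of_forall fun η => ?_) ((integrableOn_rpow_mul_min_sq hα).const_mul _) ?_
  · filter_upwards [ae_Ioi_pos_ne_one] with u hu
    exact norm_kernelIntegrand_le α (measurable_cauchyAverage _ ψ) (measurable_cauchyAverage _ φ)
      (norm_cauchyAverage_le _ ψ) (norm_cauchyAverage_le _ φ) hu.1 hu.2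
  · filter_upwards [ae_Ioi_pos_ne_one] with u hu
    unfold kernelIntegrand
    exact (((tendsto_lambdaApply_cauchyAverage hu.1 hu.2 ψ).comp tendsto_fst).mul
      ((tendsto_lambdaApply_cauchyAverage hu.1 hu.2 φ).comp tendsto_snd)).div_const _

lemma kernelPairing_resolvent {c α : ℝ} (hα : α ∈ Ioo (2 : ℝ) 4) {z w : ℂ} (hz : z.im ≠ 0)
    (hw : w.im ≠ 0) :
    kernelPairing c α (fun x : ℝ => (z - (x : ℂ))⁻¹) (fun y : ℝ => (w - (y : ℂ))⁻¹) =
      resolventCov c α z w := by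
  rw [(covIntegrand_integrableOn_and_integral hα hz hw).2, kernelPairing]
  congr 1
  refine integral_congr_ae ?_
  filter_upwards [ae_Ioi_pos_ne_one] with u hu
  rw [kernelIntegrand_eq _ _ _ hu.1, lambdaApply_resolvent hu.1 hu.2 hz,
    lambdaApply_resolvent hu.1 hu.2 hw]

end

end HalfHeavyTail

theorem theorem3p3 (c α : ℝ) (hc : 0 < c) (hα : α ∈ Ioo (2 : ℝ) 4) :
    -- the integral defining `C(z, w)` converges absolutely
    (∀ z w : ℂ, z.im ≠ 0 → w.im ≠ 0 →
      IntegrableOn (HalfHeavyTail.covIntegrand c α z w) (Ioi (0 : ℝ) ×ˢ Ioi (0 : ℝ))) ∧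
    -- the absolutely continuous part of `Λ_u` is finite
    (∀ u : ℝ, 0 < u → IntegrableOn (HalfHeavyTail.lambdaDensity u) (Icc (-2 : ℝ) 2)) ∧
    -- both pairings are absolutely convergent and the regularized one tends to the other
    (∀ ψ φ : ℝ →ᵇ ℂ,
      (∀ η₁ η₂ : ℝ, 0 < η₁ → 0 < η₂ →
        Integrable (HalfHeavyTail.pairingIntegrand c α ψ φ η₁ η₂)) ∧
      IntegrableOn (HalfHeavyTail.kernelIntegrand α ψ φ) (Ioi (0 : ℝ)) ∧
      Tendsto (fun η : ℝ × ℝ => HalfHeavyTail.regularizedPairing c α ψ φ η.1 η.2)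
        (𝓝[>] (0 : ℝ) ×ˢ 𝓝[>] (0 : ℝ)) (𝓝 (HalfHeavyTail.kernelPairing c α ψ φ))) ∧
    -- for resolvent test functions the pairing is `C(z, w)`
    (∀ z w : ℂ, z.im ≠ 0 → w.im ≠ 0 →
      HalfHeavyTail.kernelPairing c α (fun x : ℝ => (z - (x : ℂ))⁻¹)
        (fun y : ℝ => (w - (y : ℂ))⁻¹) = HalfHeavyTail.resolventCov c α z w) := by
  refine ⟨fun z w hz hw =>
      (HalfHeavyTail.covIntegrand_integrableOn_and_integral hα hz hw).1,
    fun u hu => HalfHeavyTail.integrableOn_lambdaDensity hu, fun ψ φ => ⟨fun η₁ η₂ h₁ h₂ =>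
      (HalfHeavyTail.regularizedPairing_spec hα ψ φ h₁ h₂).1, ?_, ?_⟩,
    fun z w hz hw => HalfHeavyTail.kernelPairing_resolvent hα hz hw⟩
  · exact HalfHeavyTail.integrableOn_kernelIntegrand hα ψ.continuous.measurable
      φ.continuous.measurable ψ.norm_coe_le_norm φ.norm_coe_le_norm
  · refine (HalfHeavyTail.tendsto_kernelPairing_cauchyAverage hα ψ φ).congr' ?_
    filter_upwards [prod_mem_prod self_mem_nhdsWithin self_mem_nhdsWithin] with η hη
    exact (HalfHeavyTail.regularizedPairing_spec hα ψ φ hη.1 hη.2).2.symm
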